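/- Let $d\ge 1$ be an integer and $q\in\mathbb C\setminus\{0\}$. For $n\ge 0$ let $\mathcal F_{d,n}\cong(\mathbb Z/d\mathbb Z)^n\rtimes B_n$ be the modular framed braid group, with generators $\sigma_1,\dots,\sigma_{n-1},t_1,\dots,t_n$, the braid relations for the $\sigma_i$, and $t_it_j=t_jt_i$, $t_j\sigma_i=\sigma_it_{s_i(j)}$, $t_j^d=1$, where $s_i=(i\ \,i+1)$. Let ${\rm Y}_{d,n}(q)$ be the Yokonuma--Hecke algebra, the quotient of $\mathbb C\mathcal F_{d,n}$ by the two-sided ideal generated by $\sigma_i^2-1-(q-q^{-1})e_i\sigma_i$ ($1\le i\le n-1$), where $e_i=\frac1d\sum_{s=1}^{d}t_i^st_{i+1}^{-s}$; write $g_i$ for the image of $\sigma_i$. Let ${\rm x}_1,\dots,{\rm x}_{d-1}\in\mathbb C$ be a solution of the E-system $$\frac1d\sum_{s=0}^{d-1}{\rm x}_{m+s}{\rm x}_{d-s}={\rm x}_m\cdot\frac1d\sum_{s=0}^{d-1}{\rm x}_s{\rm x}_{d-s}\qquad(1\le m\le d-1),$$ with indices taken modulo $d$ and ${\rm x}_0:=1$.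 (The solutions are parametrized by the non-empty subsets $D\subseteq\mathbb Z/d\mathbb Z$, whence the notation ${\rm tr}_{d,D}$ below.) Then there is a unique linear map ${\rm tr}_{d,D}:\bigcup_{n\ge 0}{\rm Y}_{d,n}(q)\to\mathbb C[z]$ (that is, a unique family of $\mathbb C$-linear maps on the ${\rm Y}_{d,n}(q)$ compatible with the natural maps ${\rm Y}_{d,n}(q)\to{\rm Y}_{d,n+1}(q)$), the specialized trace, such that 1. ${\rm tr}_{d,D}(ab)={\rm tr}_{d,D}(ba)$ for $a,b\in{\rm Y}_{d,n}(q)$, $n\ge 0$; 2. ${\rm tr}_{d,D}(1)=1$; 3. ${\rm tr}_{d,D}(a g_n)=z\,{\rm tr}_{d,D}(a)$ for $a\in{\rm Y}_{d,n}(q)$, $n\ge 1$; 4. ${\rm tr}_{d,D}(a t_{n+1}^s)={\rm x}_s\,{\rm tr}_{d,D}(a)$ for $a\in{\rm Y}_{d,n}(q)$, $n\ge 0$, $1\le s\le d-1$. Moreover, it is multiplicative on connected sums of classical braids: for all $n,m\ge 1$, $\alpha\in B_n$ and $\beta\in B_m$, $${\rm tr}_{d,D}(\alpha\#\beta)={\rm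 tr}_{d,D}(\alpha)\,{\rm tr}_{d,D}(\beta).$$ Here $\alpha\#\beta=\alpha^{[0]}\beta^{[n-1]}\in B_{n+m-1}$, where $\alpha^{[0]}$ is the image of $\alpha$ under $\sigma_i\mapsto\sigma_i$ and $\beta^{[n-1]}$ the image of $\beta$ under $\sigma_i\mapsto\sigma_{n+i-1}$, and a braid is evaluated through the natural homomorphism $B_k\to{\rm Y}_{d,k}(q)$, $\sigma_i\mapsto g_i$. -/

import Mathlib

open Polynomial

noncomputable section

namespace YokonumaHecke

/-! Strands and generators are numbered from `0`: the generator `σ i` (with `i + 1 < n`) crosses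
strands `i` and `i + 1`, and `t j` (with `j < n`) is the framing generator of strand `j`. -/

/-! ### The classical braid group -/

/-- Index set of the standard generators of the braid group on `n` strands. -/
abbrev Crossing (n : ℕ) : Type := {i : ℕ // i + 1 < n}

/-- The relators of the braid group on `n` strands. -/
inductive BraidRel (n : ℕ) : FreeGroup (Crossing n) → Prop
  | braid (i j : Crossing n) (h : i.1 + 1 = j.1 ∨ j.1 + 1 = i.1) :
      BraidRel n ((FreeGroup.of i * FreeGroup.of j * FreeGroup.of i) *
        (FreeGroup.of j * FreeGroup.of i * FreeGroup.of j)⁻¹)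
  | comm (i j : Crossing n) (h : i.1 + 1 < j.1 ∨ j.1 + 1 < i.1) :
      BraidRel n ((FreeGroup.of i * FreeGroup.of j) * (FreeGroup.of j * FreeGroup.of i)⁻¹)

/-- The classical braid group `B_n`. -/
abbrev BraidGroup (n : ℕ) : Type := PresentedGroup {r | BraidRel n r}

/-- The generator of `B_n` crossing strands `i` and `i + 1`. -/
def BraidGroup.σ {n : ℕ} (i : Crossing n) : BraidGroup n := PresentedGroup.of i

theorem BraidGroup.σ_braid {n : ℕ} (i j : Crossing n) (h : i.1 + 1 = j.1 ∨ j.1 + 1 = i.1) :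
    σ i * σ j * σ i = σ j * σ i * σ j :=
  PresentedGroup.mk_eq_mk_of_mul_inv_mem (rels := {r | BraidRel n r}) (BraidRel.braid i j h)

theorem BraidGroup.σ_comm {n : ℕ} (i j : Crossing n) (h : i.1 + 1 < j.1 ∨ j.1 + 1 < i.1) :
    σ i * σ j = σ j * σ i :=
  PresentedGroup.mk_eq_mk_of_mul_inv_mem (rels := {r | BraidRel n r}) (BraidRel.comm i j h)

/-- The homomorphism `B_n → B_N`, `σ_i ↦ σ_{i + k}`, defined when `n + k ≤ N`. -/
def BraidGroup.embed {n N : ℕ} (k : ℕ) (hk : n + k ≤ N) : BraidGroup n →* BraidGroup N :=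
  PresentedGroup.toGroup (rels := {r | BraidRel n r})
    (f := fun i => σ (⟨i.1 + k, by have := i.2; omega⟩ : Crossing N)) (by
      rintro _ (⟨i, j, h⟩ | ⟨i, j, h⟩)
      · simp only [map_mul, map_inv, FreeGroup.lift_apply_of, mul_inv_eq_one]
        exact σ_braid _ _ (by simp only; omega)
      · simp only [map_mul, map_inv, FreeGroup.lift_apply_of, mul_inv_eq_one]
        exact σ_comm _ _ (by simp only; omega))

/-- The connected sum `α # β = α^{[0]} β^{[n-1]} ∈ B_{n+m-1}` of `α ∈ B_n` and `β ∈ B_m`,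
for `n, m ≥ 1`. -/
def BraidGroup.connectedSum {n m : ℕ} (hn : 1 ≤ n) (hm : 1 ≤ m)
    (α : BraidGroup n) (β : BraidGroup m) : BraidGroup (n + m - 1) :=
  embed 0 (by omega) α * embed (n - 1) (by omega) β

/-! ### The modular framed braid group -/

/-- The generators of the (modular) framed braid group on `n` strands. -/
inductive FramedGen (n : ℕ) : Type
  | sigma (i : Crossing n) : FramedGen n
  | t (j : Fin n) : FramedGen n

/-- The transposition `s_i = (i, i + 1)` of the strands. -/
def strandSwap {n : ℕ} (i : Crossing n) : Equiv.Perm (Fin n) :=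
  Equiv.swap ⟨i.1, by have := i.2; omega⟩ ⟨i.1 + 1, i.2⟩

/-- The generator `σ_i` in the free group on the framed generators. -/
abbrev FramedGen.freeσ {n : ℕ} (i : Crossing n) : FreeGroup (FramedGen n) :=
  FreeGroup.of (FramedGen.sigma i)

/-- The generator `t_j` in the free group on the framed generators. -/
abbrev FramedGen.freeT {n : ℕ} (j : Fin n) : FreeGroup (FramedGen n) :=
  FreeGroup.of (FramedGen.t j)

open FramedGen in
/-- The relators of the modular framed braid group: the braid relations, commutation of the
framings, `t_j σ_i = σ_i t_{s_i(j)}`, and `t_j ^ d = 1`. -/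
inductive FramedRel (d n : ℕ) : FreeGroup (FramedGen n) → Prop
  | braid (i j : Crossing n) (h : i.1 + 1 = j.1 ∨ j.1 + 1 = i.1) :
      FramedRel d n ((freeσ i * freeσ j * freeσ i) * (freeσ j * freeσ i * freeσ j)⁻¹)
  | comm (i j : Crossing n) (h : i.1 + 1 < j.1 ∨ j.1 + 1 < i.1) :
      FramedRel d n ((freeσ i * freeσ j) * (freeσ j * freeσ i)⁻¹)
  | tt (i j : Fin n) : FramedRel d n ((freeT i * freeT j) * (freeT j * freeT i)⁻¹)
  | tσ (j : Fin n) (i : Crossing n) :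
      FramedRel d n ((freeT j * freeσ i) * (freeσ i * freeT (strandSwap i j))⁻¹)
  | modular (j : Fin n) : FramedRel d n (freeT j ^ d)

/-- The modular framed braid group `F_{d,n} ≅ (ℤ/dℤ)^n ⋊ B_n`. -/
abbrev FramedBraidGroup (d n : ℕ) : Type := PresentedGroup {r | FramedRel d n r}

namespace FramedBraidGroup

variable {d n : ℕ}

/-- The braiding generators. -/
def σ (i : Crossing n) : FramedBraidGroup d n := PresentedGroup.of (FramedGen.sigma i)

/-- The framing generators. -/
def t (j : Fin n) : FramedBraidGroup d n := PresentedGroup.of (FramedGen.t j)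

theorem σ_braid (i j : Crossing n) (h : i.1 + 1 = j.1 ∨ j.1 + 1 = i.1) :
    (σ i * σ j * σ i : FramedBraidGroup d n) = σ j * σ i * σ j :=
  PresentedGroup.mk_eq_mk_of_mul_inv_mem (rels := {r | FramedRel d n r}) (FramedRel.braid i j h)

theorem σ_comm (i j : Crossing n) (h : i.1 + 1 < j.1 ∨ j.1 + 1 < i.1) :
    (σ i * σ j : FramedBraidGroup d n) = σ j * σ i :=
  PresentedGroup.mk_eq_mk_of_mul_inv_mem (rels := {r | FramedRel d n r}) (FramedRel.comm i j h)

theorem t_comm (i j : Fin n) : (t i * t j : FramedBraidGroup d n) = t j * t i :=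
  PresentedGroup.mk_eq_mk_of_mul_inv_mem (rels := {r | FramedRel d n r}) (FramedRel.tt i j)

theorem t_mul_σ (j : Fin n) (i : Crossing n) :
    (t j * σ i : FramedBraidGroup d n) = σ i * t (strandSwap i j) :=
  PresentedGroup.mk_eq_mk_of_mul_inv_mem (rels := {r | FramedRel d n r}) (FramedRel.tσ j i)

theorem t_pow (j : Fin n) : (t j : FramedBraidGroup d n) ^ d = 1 :=
  PresentedGroup.one_of_mem (rels := {r | FramedRel d n r}) (FramedRel.modular j)

variable (d n)

/-- The natural homomorphism `B_n → F_{d,n}`, `σ_i ↦ σ_i` (all framings zero). -/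
def ofBraid : BraidGroup n →* FramedBraidGroup d n :=
  PresentedGroup.toGroup (rels := {r | BraidRel n r}) (f := fun i => σ i) (by
    rintro _ (⟨i, j, h⟩ | ⟨i, j, h⟩)
    · simp only [map_mul, map_inv, FreeGroup.lift_apply_of, mul_inv_eq_one]
      exact σ_braid _ _ h
    · simp only [map_mul, map_inv, FreeGroup.lift_apply_of, mul_inv_eq_one]
      exact σ_comm _ _ h)

/-- `σ_i`, regarded as a generator on one more strand. -/
def _root_.YokonumaHecke.Crossing.castSucc {n : ℕ} (i : Crossing n) : Crossing (n + 1) :=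
  ⟨i.1, by have := i.2; omega⟩

theorem _root_.YokonumaHecke.strandSwap_castSucc {n : ℕ} (i : Crossing n) (j : Fin n) :
    strandSwap i.castSucc j.castSucc = (strandSwap i j).castSucc := by
  simp only [strandSwap, Equiv.swap_apply_def, Crossing.castSucc, Fin.ext_iff, Fin.val_castSucc]
  split_ifs <;> rfl

/-- Images of the generators under `F_{d,n} → F_{d,n+1}`. -/
def genSucc : FramedGen n → FramedBraidGroup d (n + 1)
  | FramedGen.sigma i => σ i.castSucc
  | FramedGen.t j => t j.castSucc

/-- The natural homomorphism `F_{d,n} → F_{d,n+1}` adding a strand on the right. -/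
def incl : FramedBraidGroup d n →* FramedBraidGroup d (n + 1) :=
  PresentedGroup.toGroup (rels := {r | FramedRel d n r}) (f := genSucc d n) (by
    rintro _ (⟨i, j, h⟩ | ⟨i, j, h⟩ | ⟨i, j⟩ | ⟨j, i⟩ | ⟨j⟩)
    · simp only [map_mul, map_inv, FreeGroup.lift_apply_of, mul_inv_eq_one, genSucc]
      exact σ_braid _ _ h
    · simp only [map_mul, map_inv, FreeGroup.lift_apply_of, mul_inv_eq_one, genSucc]
      exact σ_comm _ _ h
    · simp only [map_mul, map_inv, FreeGroup.lift_apply_of, mul_inv_eq_one, genSucc]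
      exact t_comm _ _
    · simp only [map_mul, map_inv, FreeGroup.lift_apply_of, mul_inv_eq_one, genSucc]
      rw [← strandSwap_castSucc]
      exact t_mul_σ _ _
    · simp only [map_pow, FreeGroup.lift_apply_of, genSucc]
      exact t_pow _)

theorem incl_σ (i : Crossing n) : incl d n (σ i) = σ i.castSucc :=
  PresentedGroup.toGroup.of _

theorem incl_t (j : Fin n) : incl d n (t j) = t j.castSucc :=
  PresentedGroup.toGroup.of _

end FramedBraidGroup

open FramedBraidGroup

/-! ### The Yokonuma–Hecke algebra -/

/-- The element `e_i = (1/d) ∑_{s=1}^{d} t_i^s t_{i+1}^{-s}` of the group algebra `ℂ F_{d,n}`. -/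
def eElt (d : ℕ) {n : ℕ} (i : Crossing n) : MonoidAlgebra ℂ (FramedBraidGroup d n) :=
  (1 / (d : ℂ)) • ∑ s ∈ Finset.Icc 1 d, MonoidAlgebra.of ℂ (FramedBraidGroup d n)
    (t ⟨i.1, by have := i.2; omega⟩ ^ s * (t ⟨i.1 + 1, i.2⟩)⁻¹ ^ s)

/-- The quadratic relations `σ_i² = 1 + (q - q⁻¹) e_i σ_i`. -/
inductive QuadRel (d : ℕ) (q : ℂ) (n : ℕ) :
    MonoidAlgebra ℂ (FramedBraidGroup d n) → MonoidAlgebra ℂ (FramedBraidGroup d n) → Prop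
  | quad (i : Crossing n) :
      QuadRel d q n (MonoidAlgebra.of ℂ (FramedBraidGroup d n) (σ i) ^ 2)
        (1 + (q - q⁻¹) • (eElt d i * MonoidAlgebra.of ℂ (FramedBraidGroup d n) (σ i)))

/-- The Yokonuma–Hecke algebra `Y_{d,n}(q)`: the quotient of `ℂ F_{d,n}` by the two-sided ideal
generated by the elements `σ_i² - 1 - (q - q⁻¹) e_i σ_i`. -/
abbrev YHAlgebra (d : ℕ) (q : ℂ) (n : ℕ) : Type := RingQuot (QuadRel d q n)

namespace YHAlgebra

variable (d : ℕ) (q : ℂ) {n : ℕ}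

/-- The natural map `F_{d,n} → Y_{d,n}(q)`. -/
def ofFramed : FramedBraidGroup d n →* YHAlgebra d q n :=
  ((RingQuot.mkAlgHom ℂ (QuadRel d q n) :
    MonoidAlgebra ℂ (FramedBraidGroup d n) →* YHAlgebra d q n)).comp
      (MonoidAlgebra.of ℂ (FramedBraidGroup d n))

/-- The natural map `B_n → Y_{d,n}(q)`, `σ_i ↦ g_i`. -/
def ofBraid : BraidGroup n →* YHAlgebra d q n :=
  (ofFramed d q).comp (FramedBraidGroup.ofBraid d n)

/-- The braiding generator `g_i` of `Y_{d,n}(q)`. -/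
def g (i : Crossing n) : YHAlgebra d q n := ofFramed d q (σ i)

/-- The framing generator `t_j` of `Y_{d,n}(q)`. -/
def t (j : Fin n) : YHAlgebra d q n := ofFramed d q (FramedBraidGroup.t j)

theorem mapDomain_eElt (i : Crossing n) :
    MonoidAlgebra.mapDomainAlgHom ℂ ℂ (FramedBraidGroup.incl d n) (eElt d i)
      = eElt d i.castSucc := by
  simp only [eElt, map_smul, map_sum, MonoidAlgebra.of_apply, MonoidAlgebra.mapDomainAlgHom_apply,
    MonoidAlgebra.mapDomain_single, map_mul, map_pow, map_inv, incl_t]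
  rfl

/-- The natural algebra homomorphism `Y_{d,n}(q) → Y_{d,n+1}(q)` induced by
`F_{d,n} → F_{d,n+1}`. -/
def incl (n : ℕ) : YHAlgebra d q n →ₐ[ℂ] YHAlgebra d q (n + 1) :=
  RingQuot.liftAlgHom ℂ ⟨(RingQuot.mkAlgHom ℂ (QuadRel d q (n + 1))).comp
    (MonoidAlgebra.mapDomainAlgHom ℂ ℂ (FramedBraidGroup.incl d n)), by
      rintro _ _ ⟨i⟩
      have h := RingQuot.mkAlgHom_rel ℂ (QuadRel.quad (d := d) (q := q) i.castSucc)
      simp only [AlgHom.comp_apply, map_add, map_mul, map_smul, map_pow, map_one,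
        mapDomain_eElt] at h ⊢
      simpa only [MonoidAlgebra.of_apply, MonoidAlgebra.mapDomainAlgHom_apply,
        MonoidAlgebra.mapDomain_single, incl_σ] using h⟩

end YHAlgebra

/-! ### The E-system and the specialized trace -/

/-- `E^{(m)} = (1/d) ∑_{s} x_{m+s} x_{-s}`, with indices modulo `d`. -/
def ePoly {d : ℕ} [NeZero d] (x : ZMod d → ℂ) (m : ZMod d) : ℂ :=
  (1 / (d : ℂ)) * ∑ s : ZMod d, x (m + s) * x (-s)

/-- `(x_1, …, x_{d-1})`, extended by `x_0 = 1`, is a solution of the E-system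
`E^{(m)} = x_m E^{(0)}` for `1 ≤ m ≤ d - 1`. -/
structure IsESolution {d : ℕ} [NeZero d] (x : ZMod d → ℂ) : Prop where
  zero : x 0 = 1
  eq : ∀ m : ZMod d, m ≠ 0 → ePoly x m = x m * ePoly x 0

/-- The rules of the Markov trace with framing parameters `x_s ∈ ℂ` and values in `ℂ[z]`
(here `z` is `X`). A linear map on `⋃ₙ Y_{d,n}(q)` is a family of linear maps on the
`Y_{d,n}(q)` compatible with the inclusions. -/
structure IsMarkovTrace (d : ℕ) (q : ℂ) (x : ZMod d → ℂ)
    (tr : ∀ n : ℕ, YHAlgebra d q n →ₗ[ℂ] ℂ[X]) : Prop where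
  compat : ∀ (n : ℕ) (a : YHAlgebra d q n), tr (n + 1) (YHAlgebra.incl d q n a) = tr n a
  tr_mul_comm : ∀ (n : ℕ) (a b : YHAlgebra d q n), tr n (a * b) = tr n (b * a)
  tr_one : ∀ n : ℕ, tr n 1 = 1
  /-- With `n + 1` strands, the new generator `g_{n+1}` crosses the last two of `n + 2` strands. -/
  markov : ∀ (n : ℕ) (a : YHAlgebra d q (n + 1)),
    tr (n + 2) (YHAlgebra.incl d q (n + 1) a * YHAlgebra.g d q ⟨n, by omega⟩)
      = X * tr (n + 1) a
  framing : ∀ (n : ℕ) (a : YHAlgebra d q n) (s : ℕ), 1 ≤ s → s ≤ d - 1 →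
    tr (n + 1) (YHAlgebra.incl d q n a * YHAlgebra.t d q (Fin.last n) ^ s)
      = C (x (s : ZMod d)) * tr n a

end YokonumaHecke

end

noncomputable section

/-! Everything rests on one reduction (`mem_markovSpan`): an element on `n + 1` strands is a
combination of words in which the last strand is only framed, `a t_{n+1}^s`, or is braided exactly
once, `a g_n b`, with `a` and `b` on `n` strands. The rules of the trace express its values on such
words through values on `n` strands, so uniqueness follows by induction on `n`. The reduction is
proved for arbitrary representations over arbitrary coefficient rings, because it is applied both to
the Yokonuma–Hecke algebra and to a product of R-matrix representations.

Existence comes from R-matrices. Each strand carries a label: a colour `c` in `ZMod d` and a number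
below `N c`. Let `t_j` act by the root of unity of the colour of strand `j`, and let `σ_i` act by
the Hecke-type R-matrix on labels of equal colour and by the plain flip on labels of different
colours. By orthogonality of characters `e_i` acts as the projector onto equal colours, and the
quadratic relation holds. If a label with number `j` has weight `z q^{-(2j+1)}`, the partial trace
of the R-matrix over the last strand is the scalar `z`. The weighted trace then obeys the Markov
rule, and the framing rule with parameters `∑_c W_c ω_c^s`, where `W_c` is the total weight of
colour `c`. By the reduction, the trace of a fixed word is a polynomial in the `W_c` that does not
depend on `N` (`exists_tracePoly`). For generic `q` and `z` each `W_c` takes infinitely many values,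
so identities valid for all `N` are polynomial identities. They survive the specialization of `q`,
and of the `W_c` to the inverse discrete Fourier transform of `x` (`exists_isMarkovTrace`). Of the
E-system only the normalization `x 0 = 1` enters here.

The E-system itself is needed for multiplicativity: it gives `tr(a e_n) = E tr(a)` with a constant
`E` for all `a` avoiding the last strand (`tr_incl_mul_eLast`), while `tr(a e_n g_n) = z tr(a)`.
Braids lie in the subalgebra generated by the `g_i` and `e_i`, which has its own reduction: the last
strand enters through a single factor `1`, `g`, `e` or `e g` (`mem_btLastSpan`). Removing the last
strand of `β` multiplies both sides of the claim by the same factor `1`, `z`, `E` or `z`. On one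
strand this subalgebra consists of scalars, which ends the induction (`tr_mul_shift`). -/

namespace YokonumaHecke

/-! ### Generation and commutation in the framed braid groups -/

namespace FramedBraidGroup

variable {d n : ℕ}

/-- Induction on the elements of the framed braid group through its generators. -/
theorem induction_generators {p : FramedBraidGroup d n → Prop}
    (hσ : ∀ i, p (σ i)) (ht : ∀ j, p (t j)) (one : p 1) (mul : ∀ a b, p a → p b → p (a * b))
    (inv : ∀ a, p a → p a⁻¹) (f : FramedBraidGroup d n) : p f := by
  have h : f ∈ Subgroup.closure (Set.range (PresentedGroup.of (rels := {r | FramedRel d n r}))) := by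
    rw [PresentedGroup.closure_range_of]; trivial
  induction h using Subgroup.closure_induction with
  | mem x hx =>
    obtain ⟨i | j, rfl⟩ := hx
    · exact hσ i
    · exact ht j
  | one => exact one
  | mul a b _ _ ha hb => exact mul a b ha hb
  | inv a _ ha => exact inv a ha

theorem t_mul_σ_of_ne (j : Fin n) (i : Crossing n) (h₁ : j.1 ≠ i.1) (h₂ : j.1 ≠ i.1 + 1) :
    (t j * σ i : FramedBraidGroup d n) = σ i * t j := by
  rw [t_mul_σ, strandSwap, Equiv.swap_apply_of_ne_of_ne] <;> simpa [Fin.ext_iff]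

theorem t_mul_σ_left (i : Crossing n) (h₁ : i.1 < n) :
    (t ⟨i.1, h₁⟩ * σ i : FramedBraidGroup d n) = σ i * t ⟨i.1 + 1, i.2⟩ := by
  rw [t_mul_σ, strandSwap, Equiv.swap_apply_left]

theorem t_mul_σ_right (i : Crossing n) (h₁ : i.1 < n) :
    (t ⟨i.1 + 1, i.2⟩ * σ i : FramedBraidGroup d n) = σ i * t ⟨i.1, h₁⟩ := by
  rw [t_mul_σ, strandSwap, Equiv.swap_apply_right]

theorem commute_t_last_incl (a : FramedBraidGroup d n) :
    Commute (t (Fin.last n)) (incl d n a) := by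
  induction a using induction_generators with
  | hσ i =>
    rw [incl_σ]
    refine t_mul_σ_of_ne _ _ ?_ ?_ <;> simp only [Fin.val_last, Crossing.castSucc] <;>
      have := i.2 <;> omega
  | ht j => exact t_comm _ _
  | one => simp
  | mul a b ha hb => rw [map_mul]; exact ha.mul_right hb
  | inv a ha => rw [map_inv]; exact ha.inv_right

/-- The crossing of the last two strands. -/
def _root_.YokonumaHecke.Crossing.last (n : ℕ) : Crossing (n + 2) := ⟨n, by omega⟩

theorem _root_.YokonumaHecke.Crossing.eq_castSucc_or_eq_last {n : ℕ} (i : Crossing (n + 2)) :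
    (∃ j : Crossing (n + 1), i = j.castSucc) ∨ i = Crossing.last n := by
  rcases i with ⟨i, hi⟩
  by_cases h : i + 1 < n + 1
  · exact Or.inl ⟨⟨i, h⟩, rfl⟩
  · exact Or.inr (Subtype.ext (by simp only [Crossing.last]; omega))

theorem commute_σ_last_incl_incl (a : FramedBraidGroup d n) :
    Commute (σ (Crossing.last n)) (incl d (n + 1) (incl d n a)) := by
  induction a using induction_generators with
  | hσ j =>
    rw [incl_σ, incl_σ]
    exact σ_comm _ _ (Or.inr (by have := j.2; simp only [Crossing.castSucc, Crossing.last]; omega))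
  | ht j =>
    rw [incl_t, incl_t]
    refine (t_mul_σ_of_ne _ _ ?_ ?_).symm <;> simp only [Fin.val_castSucc, Crossing.last] <;>
      have := j.2 <;> omega
  | one => simp
  | mul a b ha hb => rw [map_mul, map_mul]; exact ha.mul_right hb
  | inv a ha => rw [map_inv, map_inv]; exact ha.inv_right

theorem semiconjBy_σ_t_last (n : ℕ) :
    SemiconjBy (σ (Crossing.last n) : FramedBraidGroup d (n + 2)) (t (Fin.last (n + 1)))
      (incl d (n + 1) (t (Fin.last n))) := by
  rw [incl_t]; exact (t_mul_σ_left (Crossing.last n) _).symm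

theorem semiconjBy_σ_t_prev (n : ℕ) :
    SemiconjBy (σ (Crossing.last n) : FramedBraidGroup d (n + 2))
      (incl d (n + 1) (t (Fin.last n))) (t (Fin.last (n + 1))) := by
  rw [incl_t]
  exact (t_mul_σ_right (Crossing.last n) (by simp only [Crossing.last]; omega)).symm

theorem eq_one_of_zero (f : FramedBraidGroup d 0) : f = 1 := by
  induction f using induction_generators with
  | hσ i => exact absurd i.2 (by omega)
  | ht j => exact j.elim0
  | one => rfl
  | mul a b ha hb => rw [ha, hb, one_mul]
  | inv a ha => rw [ha, inv_one]

end FramedBraidGroup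

/-! ### The spanning set of `Y_{d,n+1}` over `Y_{d,n}` -/

section Span

open FramedBraidGroup

variable {d : ℕ} {A B : Type*} [CommRing A] [Ring B] [Algebra A B]

/-- The quadratic relation for a representation of the framed braid group, `v` being
`(q - q⁻¹) / d`. -/
def IsQuadratic (v : A) {n : ℕ} (θ : FramedBraidGroup d n →* B) : Prop :=
  ∀ i : Crossing n, θ (σ i * σ i) = 1 + v • ∑ s ∈ Finset.Icc 1 d,
    θ (t ⟨i.1, by have := i.2; omega⟩ ^ s * (t ⟨i.1 + 1, i.2⟩)⁻¹ ^ s * σ i)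

theorem IsQuadratic.comp_incl {v : A} {n : ℕ} {θ : FramedBraidGroup d (n + 1) →* B}
    (h : IsQuadratic v θ) : IsQuadratic v (θ.comp (incl d n)) := by
  intro i
  have := h i.castSucc
  simp only [MonoidHom.comp_apply, map_mul (incl d n), map_pow (incl d n), map_inv (incl d n),
    incl_σ, incl_t]
  exact this

/-- The span of the images of the elements `a t_{n+1}^s` and `a σ_n b` with `a, b` on `n`
strands. -/
def markovSpan (A : Type*) {B : Type*} [CommRing A] [Ring B] [Algebra A B] {n : ℕ}
    (θ : FramedBraidGroup d (n + 1) →* B) : Submodule A B :=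
  Submodule.span A ({x | ∃ (a : FramedBraidGroup d n) (s : ℕ),
      x = θ (incl d n a * t (Fin.last n) ^ s)} ∪
    {x | ∃ (a b : FramedBraidGroup d n) (i : Crossing (n + 1)), i.1 + 1 = n ∧
      x = θ (incl d n a * σ i * incl d n b)})

variable {n : ℕ} {θ : FramedBraidGroup d (n + 1) →* B}

theorem mem_markovSpan_t (a : FramedBraidGroup d n) (s : ℕ) :
    θ (incl d n a * t (Fin.last n) ^ s) ∈ markovSpan A θ :=
  Submodule.subset_span (Or.inl ⟨a, s, rfl⟩)

theorem mem_markovSpan_σ (a b : FramedBraidGroup d n) (i : Crossing (n + 1)) (hi : i.1 + 1 = n) :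
    θ (incl d n a * σ i * incl d n b) ∈ markovSpan A θ :=
  Submodule.subset_span (Or.inr ⟨a, b, i, hi, rfl⟩)

/-- The elements whose left multiplication preserves a submodule. -/
def leftStabilizer (S : Submodule A B) : Subalgebra A B where
  carrier := {b | ∀ x ∈ S, b * x ∈ S}
  mul_mem' ha hb x hx := by rw [mul_assoc]; exact ha _ (hb _ hx)
  add_mem' ha hb x hx := by rw [add_mul]; exact S.add_mem (ha _ hx) (hb _ hx)
  algebraMap_mem' r x hx := by rw [← Algebra.smul_def]; exact S.smul_mem r hx

theorem mem_leftStabilizer_span {X : Set B} {b : B}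
    (h : ∀ x ∈ X, b * x ∈ Submodule.span A X) : b ∈ leftStabilizer (Submodule.span A X) := by
  intro x hx
  induction hx using Submodule.span_induction with
  | mem x hx => exact h x hx
  | zero => rw [mul_zero]; exact Submodule.zero_mem _
  | add x y _ _ hx hy => rw [mul_add]; exact Submodule.add_mem _ hx hy
  | smul r x _ hx => rw [mul_smul_comm]; exact Submodule.smul_mem _ _ hx

theorem incl_mem_leftStabilizer (c : FramedBraidGroup d n) :
    θ (incl d n c) ∈ leftStabilizer (markovSpan A θ) := by
  refine mem_leftStabilizer_span ?_
  rintro _ (⟨a, s, rfl⟩ | ⟨a, b, i, hi, rfl⟩)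
  · rw [← map_mul, ← mul_assoc, ← map_mul]; exact mem_markovSpan_t _ _
  · rw [← map_mul, ← mul_assoc, ← mul_assoc, ← map_mul]; exact mem_markovSpan_σ _ _ _ hi

theorem t_last_mem_leftStabilizer :
    θ (t (Fin.last n)) ∈ leftStabilizer (markovSpan A θ) := by
  refine mem_leftStabilizer_span ?_
  rintro _ (⟨a, s, rfl⟩ | ⟨a, b, i, hi, rfl⟩)
  · rw [← map_mul, ← mul_assoc, (commute_t_last_incl a).eq, mul_assoc, ← pow_succ']
    exact mem_markovSpan_t _ _
  · obtain ⟨m, rfl⟩ : ∃ m, n = m + 1 := ⟨i.1, hi.symm⟩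
    obtain rfl : i = Crossing.last m := Subtype.ext (Nat.succ.inj hi)
    rw [← map_mul, ← mul_assoc, ← mul_assoc, (commute_t_last_incl a).eq, mul_assoc (incl d _ a),
      ← (semiconjBy_σ_t_prev m).eq, ← mul_assoc, mul_assoc _ _ (incl d _ b), ← map_mul]
    exact mem_markovSpan_σ _ _ _ rfl

/-- The critical word `σ c σ b'` contains the last crossing twice, and `ih` expands the middle
factor `c` one strand lower. If `c = a t^s`, the two crossings can be brought together and the
quadratic relation removes one of them; if `c = a σ' b`, a braid relation does so. -/
theorem σ_last_mem_leftStabilizer {v : A} {m : ℕ} {θ : FramedBraidGroup d (m + 2) →* B}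
    (hθ : IsQuadratic v θ)
    (ih : ∀ f, θ (incl d (m + 1) f) ∈ markovSpan A (θ.comp (incl d (m + 1)))) :
    θ (σ (Crossing.last m)) ∈ leftStabilizer (markovSpan A θ) := by
  have hσ : ∀ a b : FramedBraidGroup d (m + 1),
      θ (incl d (m + 1) a * (σ (Crossing.last m) * incl d (m + 1) b)) ∈ markovSpan A θ :=
    fun a b => by rw [← mul_assoc]; exact mem_markovSpan_σ _ _ _ rfl
  have htt := fun s => ((semiconjBy_σ_t_last (d := d) m).pow_right s).eq
  have htp := fun s => ((semiconjBy_σ_t_prev (d := d) m).pow_right s).eq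
  have hc := fun a => (commute_σ_last_incl_incl (d := d) (n := m) a).eq
  have htc := fun (a : FramedBraidGroup d (m + 1)) s => ((commute_t_last_incl a).pow_left s).eq
  have hq : θ (σ (Crossing.last m) * σ (Crossing.last m)) = 1 + v • ∑ k ∈ Finset.Icc 1 d,
      θ (incl d (m + 1) (t (Fin.last m)) ^ k * (t (Fin.last (m + 1)))⁻¹ ^ k *
        σ (Crossing.last m)) := by
    rw [incl_t]; exact hθ (Crossing.last m)
  refine mem_leftStabilizer_span ?_
  rintro _ (⟨c, r, rfl⟩ | ⟨c, b', i, hi, rfl⟩)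
  · rw [← map_mul, ← htc, ← mul_assoc, htt, mul_assoc, ← map_pow]
    exact hσ _ _
  · obtain rfl : i = Crossing.last m := Subtype.ext (Nat.succ.inj hi)
    have hc' := ih c
    rw [map_mul, map_mul, mul_assoc]
    generalize θ (incl d (m + 1) c) = x at hc'
    induction hc' using Submodule.span_induction with
    | mem x hx =>
      obtain ⟨a, s, rfl⟩ | ⟨a, b, i, hi, rfl⟩ := hx
      · have h₁ : σ (Crossing.last m) * (incl d (m + 1) (incl d m a * t (Fin.last m) ^ s) *
            (σ (Crossing.last m) * incl d (m + 1) b')) =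
            incl d (m + 1) (incl d m a) * t (Fin.last (m + 1)) ^ s *
              (σ (Crossing.last m) * σ (Crossing.last m)) * incl d (m + 1) b' := by
          rw [map_mul, map_pow, ← mul_assoc, ← mul_assoc, ← mul_assoc, hc, mul_assoc _ (σ _) (_ ^ s),
            htp]
          simp only [mul_assoc]
        rw [MonoidHom.comp_apply, ← map_mul, ← map_mul, ← map_mul, h₁, map_mul, map_mul, hq,
          mul_add, mul_one, add_mul, ← map_mul, mul_smul_comm, smul_mul_assoc, Finset.mul_sum,
          Finset.sum_mul]
        -- The two terms of the quadratic relation: no crossing left, or one crossing with framings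
        -- that can be moved to the lower strand on either side.
        refine Submodule.add_mem _ ?_ (Submodule.smul_mem _ _ (Submodule.sum_mem _ fun k _ => ?_))
        · rw [mul_assoc, htc, ← mul_assoc, ← map_mul]
          exact mem_markovSpan_t _ _
        · have h₂ : (t (Fin.last (m + 1)))⁻¹ ^ k * σ (Crossing.last m) =
              σ (Crossing.last m) * incl d (m + 1) ((t (Fin.last m))⁻¹ ^ k) := by
            rw [map_pow, map_inv]
            exact ((semiconjBy_σ_t_prev (d := d) m).inv_right.pow_right k).eq.symm
          rw [← map_mul, ← map_mul]
          have h₃ : incl d (m + 1) (incl d m a) * t (Fin.last (m + 1)) ^ s *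
              (incl d (m + 1) (t (Fin.last m)) ^ k * (t (Fin.last (m + 1)))⁻¹ ^ k *
                σ (Crossing.last m)) * incl d (m + 1) b' =
              incl d (m + 1) (incl d m a * t (Fin.last m) ^ k) * (σ (Crossing.last m) *
                incl d (m + 1) (t (Fin.last m) ^ s * (t (Fin.last m))⁻¹ ^ k * b')) := by
            simp only [map_mul, ← map_pow, mul_assoc]
            rw [← mul_assoc (t _ ^ s), htc, ← mul_assoc _ (σ _), h₂]
            simp only [mul_assoc]
            rw [← mul_assoc (t _ ^ s) (σ _), ← htp, map_pow (incl d (m + 1)) _ s]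
            simp only [mul_assoc]
          exact h₃ ▸ hσ _ _
      · obtain ⟨m, rfl⟩ : ∃ l, m = l + 1 := ⟨i.1, hi.symm⟩
        have hb : σ (Crossing.last (m + 1)) * σ i.castSucc * σ (Crossing.last (m + 1)) =
            (σ i.castSucc * σ (Crossing.last (m + 1)) * σ i.castSucc :
              FramedBraidGroup d (m + 3)) :=
          σ_braid _ _ (Or.inr hi)
        have h₄ : σ (Crossing.last (m + 1)) *
            (incl d (m + 2) (incl d (m + 1) a * σ i * incl d (m + 1) b) *
              (σ (Crossing.last (m + 1)) * incl d (m + 2) b')) =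
            incl d (m + 2) (incl d (m + 1) a * σ i) * (σ (Crossing.last (m + 1)) *
              incl d (m + 2) (σ i * incl d (m + 1) b * b')) := by
          have h₅ : ∀ x, σ (Crossing.last (m + 1)) * (σ i.castSucc * (σ (Crossing.last (m + 1)) *
              x)) = (σ i.castSucc * (σ (Crossing.last (m + 1)) * (σ i.castSucc * x)) :
                FramedBraidGroup d (m + 3)) := fun x => by
            simpa only [mul_assoc] using congrArg (· * x) hb
          have h₆ : ∀ a x, σ (Crossing.last (m + 1)) * (incl d (m + 2) (incl d (m + 1) a) * x) =
              incl d (m + 2) (incl d (m + 1) a) * (σ (Crossing.last (m + 1)) * x) := fun a x => by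
            simpa only [mul_assoc] using congrArg (· * x) (hc a)
          simp only [map_mul, incl_σ, mul_assoc]
          rw [h₆, ← h₆ b, h₅]
        rw [MonoidHom.comp_apply, ← map_mul, ← map_mul, ← map_mul, h₄]
        exact hσ _ _
    | zero => rw [zero_mul, mul_zero]; exact Submodule.zero_mem _
    | add x x' _ _ hx hx' => rw [add_mul, mul_add]; exact Submodule.add_mem _ hx hx'
    | smul r x _ hx =>
      rw [smul_mul_assoc, mul_smul_comm]; exact Submodule.smul_mem _ _ hx

/-- The left stabilizer of the span is a subalgebra and the span contains `1`, so it suffices that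
the stabilizer contains the generators and their inverses. The induction carries `f` and `f⁻¹`
together to pass through the inverses. -/
theorem mem_markovSpan_of_σ [NeZero d] {v : A} (hθ : IsQuadratic v θ)
    (h : ∀ i : Crossing (n + 1), i.1 + 1 = n → θ (σ i) ∈ leftStabilizer (markovSpan A θ))
    (f : FramedBraidGroup d (n + 1)) : θ f ∈ markovSpan A θ := by
  set S := leftStabilizer (markovSpan A θ)
  suffices hf : θ f ∈ S ∧ θ f⁻¹ ∈ S by
    simpa using hf.1 1 (by simpa using mem_markovSpan_t (A := A) (θ := θ) 1 0)
  have ht : ∀ j, θ (t j) ∈ S := fun j => by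
    obtain ⟨j, rfl⟩ | rfl := j.eq_castSucc_or_eq_last
    · rw [← incl_t]; exact incl_mem_leftStabilizer _
    · exact t_last_mem_leftStabilizer
  have ht' : ∀ j, θ (t j)⁻¹ ∈ S := fun j => by
    have h₁ : (t j : FramedBraidGroup d (n + 1))⁻¹ = t j ^ (d - 1) := by
      rw [inv_eq_iff_mul_eq_one, ← pow_succ', Nat.sub_add_cancel NeZero.one_le, t_pow]
    rw [h₁, map_pow]
    exact pow_mem (ht j) _
  have hσ : ∀ i, θ (σ i) ∈ S := fun i => by
    by_cases hi : i.1 + 1 = n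
    · exact h i hi
    · have := i.2
      exact incl_σ d n ⟨i.1, by omega⟩ ▸ incl_mem_leftStabilizer _
  induction f using induction_generators with
  | hσ i =>
    refine ⟨hσ i, ?_⟩
    -- Multiplying the quadratic relation by `σ⁻¹` expresses `σ⁻¹` through `σ` and framings.
    have hi := congrArg (· * θ (σ i)⁻¹) (hθ i)
    simp only [add_mul, smul_mul_assoc, Finset.sum_mul, ← map_mul, mul_inv_cancel_right,
      one_mul] at hi
    rw [← sub_eq_iff_eq_add] at hi
    rw [← hi]
    refine sub_mem (hσ i) (S.smul_mem (sum_mem fun k _ => ?_) v)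
    rw [map_mul, map_pow, map_pow]
    exact mul_mem (pow_mem (ht _) _) (pow_mem (ht' _) _)
  | ht j => exact ⟨ht j, ht' j⟩
  | one => simp only [inv_one, map_one, and_self]; exact one_mem S
  | mul a b ha hb =>
    rw [mul_inv_rev, map_mul, map_mul]
    exact ⟨mul_mem ha.1 hb.1, mul_mem hb.2 ha.2⟩
  | inv a ha => rw [inv_inv]; exact ha.symm

/-- Words on `n + 1` strands are combinations of words in which the last strand is framed but
not braided, or is braided exactly once. -/
theorem mem_markovSpan [NeZero d] {v : A} (n : ℕ) (θ : FramedBraidGroup d (n + 1) →* B)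
    (hθ : IsQuadratic v θ) (f : FramedBraidGroup d (n + 1)) : θ f ∈ markovSpan A θ := by
  induction n with
  | zero =>
    refine mem_markovSpan_of_σ hθ (fun i hi => absurd i.2 (by omega)) f
  | succ n ih =>
    refine mem_markovSpan_of_σ hθ (fun i hi => ?_) f
    obtain rfl : i = Crossing.last n := Subtype.ext (Nat.succ.inj hi)
    exact σ_last_mem_leftStabilizer hθ fun f => ih (θ.comp (incl d (n + 1))) hθ.comp_incl f

end Span

end YokonumaHecke

namespace YokonumaHecke

/-! ### Uniqueness of the Markov trace -/

namespace YHAlgebra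

variable (d : ℕ) (q : ℂ) {n : ℕ}

theorem incl_ofFramed (f : FramedBraidGroup d n) :
    incl d q n (ofFramed d q f) = ofFramed d q (FramedBraidGroup.incl d n f) := by
  simp only [incl, ofFramed, MonoidHom.comp_apply, MonoidHom.coe_coe,
    RingQuot.liftAlgHom_mkAlgHom_apply, AlgHom.comp_apply, MonoidAlgebra.of_apply,
    MonoidAlgebra.mapDomainAlgHom_apply, MonoidAlgebra.mapDomain_single]

theorem isQuadratic_ofFramed :
    IsQuadratic ((q - q⁻¹) / d) (ofFramed d q : FramedBraidGroup d n →* YHAlgebra d q n) := by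
  intro i
  have h := RingQuot.mkAlgHom_rel ℂ (QuadRel.quad (d := d) (q := q) i)
  simp only [eElt, map_add, map_mul, map_smul, map_one, map_sum, pow_two, smul_mul_assoc,
    Finset.sum_mul] at h
  simp only [map_mul]
  refine h.trans ?_
  rw [smul_smul, mul_one_div]
  rfl

variable {d q}

theorem induction_ofFramed {p : YHAlgebra d q n → Prop} (of : ∀ f, p (ofFramed d q f))
    (add : ∀ a b, p a → p b → p (a + b)) (smul : ∀ (c : ℂ) a, p a → p (c • a))
    (a : YHAlgebra d q n) : p a := by
  obtain ⟨a, rfl⟩ := RingQuot.mkAlgHom_surjective ℂ _ a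
  induction a using MonoidAlgebra.induction_on with
  | of m => exact of m
  | add x y hx hy => rw [map_add]; exact add _ _ hx hy
  | smul r x hx => rw [map_smul]; exact smul _ _ hx

theorem linearMap_ext {M : Type*} [AddCommMonoid M] [Module ℂ M]
    {φ ψ : YHAlgebra d q n →ₗ[ℂ] M} (h : ∀ f, φ (ofFramed d q f) = ψ (ofFramed d q f)) :
    φ = ψ := by
  ext1 a
  induction a using induction_ofFramed with
  | of f => exact h f
  | add a b ha hb => rw [map_add, map_add, ha, hb]
  | smul c a ha => rw [map_smul, map_smul, ha]

/-- The elements of `Y_{d,n+1}(q)` are combinations of elements `a t_{n+1}^s` and `a g_n b`. -/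
theorem induction_markov [NeZero d] {p : YHAlgebra d q (n + 1) → Prop}
    (ht : ∀ a s, p (incl d q n a * t d q (Fin.last n) ^ s))
    (hg : ∀ a b (i : Crossing (n + 1)), i.1 + 1 = n → p (incl d q n a * g d q i * incl d q n b))
    (add : ∀ a b, p a → p b → p (a + b)) (smul : ∀ (c : ℂ) a, p a → p (c • a))
    (a : YHAlgebra d q (n + 1)) : p a := by
  induction a using induction_ofFramed with
  | of f =>
    have hf := mem_markovSpan n _ (isQuadratic_ofFramed d q) f
    generalize ofFramed d q f = y at hf
    induction hf using Submodule.span_induction with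
    | mem x hx =>
      obtain ⟨a, s, rfl⟩ | ⟨a, b, i, hi, rfl⟩ := hx
      · rw [map_mul, map_pow, ← incl_ofFramed]; exact ht _ _
      · rw [map_mul, map_mul, ← incl_ofFramed, ← incl_ofFramed]; exact hg _ _ _ hi
    | zero => simpa using smul 0 _ (ht 0 0)
    | add x y _ _ hx hy => exact add _ _ hx hy
    | smul c x _ hx => exact smul _ _ hx
  | add a b ha hb => exact add _ _ ha hb
  | smul c a ha => exact smul _ _ ha

theorem t_pow (j : Fin n) : t d q j ^ d = 1 := by
  rw [t, ← map_pow, FramedBraidGroup.t_pow, map_one]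

end YHAlgebra

namespace IsMarkovTrace

open YHAlgebra

variable {d : ℕ} {q : ℂ} {x : ZMod d → ℂ} {tr tr' : ∀ n : ℕ, YHAlgebra d q n →ₗ[ℂ] ℂ[X]}

/-- Both sides depend only on `s` modulo `d`, since `t ^ d = 1`; the residue `0` is compatibility
with the inclusion, because `x 0 = 1`. -/
theorem framing_pow [NeZero d] (h : IsMarkovTrace d q x tr) (hx : x 0 = 1) (n : ℕ)
    (a : YHAlgebra d q n) (s : ℕ) :
    tr (n + 1) (incl d q n a * t d q (Fin.last n) ^ s) = C (x s) * tr n a := by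
  have hs : t d q (Fin.last n) ^ s = t d q (Fin.last n) ^ (s % d) := by
    conv_lhs => rw [← Nat.mod_add_div s d, pow_add, pow_mul, t_pow, one_pow, mul_one]
  rw [hs, ← ZMod.natCast_mod s d]
  have := Nat.mod_lt s (NeZero.pos d)
  rcases Nat.eq_zero_or_pos (s % d) with h0 | h0
  · rw [h0, pow_zero, mul_one, Nat.cast_zero, hx, map_one, one_mul, h.compat]
  · exact h.framing n a _ h0 (by omega)

theorem markov_mul (h : IsMarkovTrace d q x tr) (n : ℕ) (a b : YHAlgebra d q (n + 1)) :
    tr (n + 2) (incl d q (n + 1) a * g d q (Crossing.last n) * incl d q (n + 1) b) =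
      X * tr (n + 1) (a * b) := by
  rw [h.tr_mul_comm, ← mul_assoc, ← map_mul, h.tr_mul_comm (n + 1) a b]
  exact h.markov n _

theorem unique [NeZero d] (h : IsMarkovTrace d q x tr) (h' : IsMarkovTrace d q x tr')
    (hx : x 0 = 1) : tr = tr' := by
  funext n
  induction n with
  | zero =>
    refine linearMap_ext fun f => ?_
    rw [FramedBraidGroup.eq_one_of_zero f, map_one, h.tr_one, h'.tr_one]
  | succ n ih =>
    ext1 a
    induction a using induction_markov with
    | ht a s => rw [h.framing_pow hx, h'.framing_pow hx, ih]
    | hg a b i hi =>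
      obtain ⟨m, rfl⟩ : ∃ l, n = l + 1 := ⟨i.1, hi.symm⟩
      obtain rfl : i = Crossing.last m := Subtype.ext (Nat.succ.inj hi)
      rw [h.markov_mul, h'.markov_mul, ih]
    | add a b ha hb => rw [map_add, map_add, ha, hb]
    | smul c a ha => rw [map_smul, map_smul, ha]

end IsMarkovTrace

end YokonumaHecke

namespace YokonumaHecke

/-! ### R-matrix representations of the framed braid groups -/

/-- The scalars entering the R-matrix representations: `q` with `q² = 1 + u q`, `v = u / d`, and
`d`-th roots of unity `ω c` indexed by the colours, satisfying the orthogonality relations. -/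
structure RMatrixScalars (d : ℕ) (κ L : Type*) [CommRing L] [DecidableEq κ] where
  q : L
  u : L
  v : L
  ω : κ → Lˣ
  q_sq : q * q = 1 + u * q
  d_mul_v : d * v = u
  ω_pow : ∀ c, ω c ^ d = 1
  sum_ω : ∀ a b, ∑ s ∈ Finset.Icc 1 d, ((ω a ^ s * (ω b)⁻¹ ^ s : Lˣ) : L) =
    if a = b then (d : L) else 0

/-- Labels of a strand: a colour, and a number for each colour. -/
abbrev Label {κ : Type*} (N : κ → ℕ) : Type _ := Σ c : κ, Fin (N c)

namespace RMatrixScalars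

open FramedBraidGroup

variable {d : ℕ} {κ L : Type*} [CommRing L] [DecidableEq κ] (D : RMatrixScalars d κ L)
  {N : κ → ℕ} {n : ℕ}

/-- The diagonal coefficients of the R-matrix. -/
def diag (x y : Label N) : L :=
  if x.1 = y.1 then
    if (x.2 : ℕ) = y.2 then D.q else if (y.2 : ℕ) < x.2 then D.u else 0
  else 0

/-- The coefficients of the flip in the R-matrix. -/
def flip (L : Type*) [CommRing L] (x y : Label N) : L :=
  if x.1 = y.1 ∧ (x.2 : ℕ) = y.2 then 0 else 1

/-- The function equal to `1` on pairs of labels of the same colour, and to `0` elsewhere. -/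
def sameColour (L : Type*) [CommRing L] (x y : Label N) : L := if x.1 = y.1 then 1 else 0

/-- Compares the coefficients of the flip in the quadratic relation: for distinct numbers of one
colour exactly one of the two diagonal coefficients is `u`, and the other vanishes. -/
theorem diag_add (x y : Label N) :
    flip L x y * (D.diag x y + D.diag y x) = flip L x y * (D.u * sameColour L x y) := by
  unfold flip diag sameColour
  grind

/-- Compares the diagonal coefficients in the quadratic relation; for equal labels this is `q_sq`.
-/
theorem diag_sq (x y : Label N) :
    D.diag x y * D.diag x y + flip L x y * flip L y x =
      1 + D.u * sameColour L x y * D.diag x y := by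
  have := D.q_sq
  unfold flip diag sameColour
  grind

/-- The Yang–Baxter equation at the labels `x, y, z`, where `f₁, …, f₆` stand for the values of a
state at the six rearrangements of these labels. The coefficients depend only on which colours agree
and on the order of the numbers, so the check is finite. -/
theorem yangBaxter (x y z : Label N) (f₁ f₂ f₃ f₄ f₅ f₆ : L) :
    D.diag x y * (D.diag y z * (D.diag x y * f₁ + flip L x y * f₂) +
        flip L y z * (D.diag x z * f₃ + flip L x z * f₄)) +
      flip L x y * (D.diag x z * (D.diag y x * f₂ + flip L y x * f₁) +
        flip L x z * (D.diag y z * f₅ + flip L y z * f₆)) =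
    D.diag y z * (D.diag x y * (D.diag y z * f₁ + flip L y z * f₃) +
        flip L x y * (D.diag x z * f₂ + flip L x z * f₅)) +
      flip L y z * (D.diag x z * (D.diag z y * f₃ + flip L z y * f₁) +
        flip L x z * (D.diag x y * f₄ + flip L x y * f₆)) := by
  have := D.q_sq
  unfold flip diag
  obtain ⟨x, i⟩ := x
  obtain ⟨y, j⟩ := y
  obtain ⟨z, k⟩ := z
  simp only
  generalize (i : ℕ) = i
  generalize (j : ℕ) = j
  generalize (k : ℕ) = k
  by_cases hxy : x = y <;> by_cases hyz : y = z <;> by_cases hxz : x = z <;>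
    simp only [hxy, hyz, hxz] <;>
  rcases lt_trichotomy i j with h | h | h <;> rcases lt_trichotomy j k with h' | h' | h' <;>
  rcases lt_trichotomy i k with h'' | h'' | h'' <;> grind

end RMatrixScalars

end YokonumaHecke

/-! ### Crossing and framing operators, and the representation they define -/

namespace YokonumaHecke

namespace RMatrixScalars

open FramedBraidGroup

variable {d : ℕ} {κ L : Type*} [CommRing L] [DecidableEq κ] (D : RMatrixScalars d κ L)
  {N : κ → ℕ} {n : ℕ}

/-- Functions on the labellings of `n` strands. -/
abbrev States (L : Type*) (N : κ → ℕ) (n : ℕ) : Type _ := (Fin n → Label N) → L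

/-- The multiplication operator by a function of the labellings. -/
def mulOp (w : States L N n) : Module.End L (States L N n) := LinearMap.mulLeft L w

omit [DecidableEq κ] in
@[simp] theorem mulOp_apply (w φ : States L N n) (s : Fin n → Label N) :
    mulOp w φ s = w s * φ s := rfl

/-- The R-matrix acting on the strands `a` and `b`. -/
def crossOp (a b : Fin n) : Module.End L (States L N n) where
  toFun φ s := D.diag (s a) (s b) * φ s + flip L (s a) (s b) * φ (s ∘ Equiv.swap a b)
  map_add' φ ψ := by funext s; simp only [Pi.add_apply]; ring
  map_smul' r φ := by funext s; simp only [Pi.smul_apply, smul_eq_mul, RingHom.id_apply]; ring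

theorem crossOp_apply (a b : Fin n) (φ : States L N n) (s : Fin n → Label N) :
    D.crossOp a b φ s =
      D.diag (s a) (s b) * φ s + flip L (s a) (s b) * φ (s ∘ Equiv.swap a b) := rfl

theorem crossOp_braid {a b c : Fin n} (hab : a ≠ b) (hbc : b ≠ c) (hac : a ≠ c) :
    (D.crossOp a b * D.crossOp b c * D.crossOp a b : Module.End L (States L N n)) =
      D.crossOp b c * D.crossOp a b * D.crossOp b c := by
  refine LinearMap.ext fun φ => funext fun s => ?_
  have h := D.yangBaxter (s a) (s b) (s c) (φ s) (φ (s ∘ Equiv.swap a b))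
    (φ (s ∘ Equiv.swap b c)) (φ (s ∘ Equiv.swap b c ∘ Equiv.swap a b))
    (φ (s ∘ Equiv.swap a b ∘ Equiv.swap b c))
    (φ (s ∘ Equiv.swap a b ∘ Equiv.swap b c ∘ Equiv.swap a b))
  -- The braid relation in the symmetric group: both sides reach the same sixth rearrangement.
  have hs : s ∘ Equiv.swap b c ∘ Equiv.swap a b ∘ Equiv.swap b c =
      s ∘ Equiv.swap a b ∘ Equiv.swap b c ∘ Equiv.swap a b := by
    congr 1
    funext i
    simp only [Function.comp_apply, Equiv.swap_apply_def]
    grind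
  have h₁ : ∀ i j : Fin n, (s ∘ Equiv.swap i j) ∘ Equiv.swap i j = s := fun i j => by
    funext k; simp
  simp only [Module.End.mul_apply, crossOp_apply, Function.comp_apply, Equiv.swap_apply_left,
    Equiv.swap_apply_right, Equiv.swap_apply_of_ne_of_ne hab hac,
    Equiv.swap_apply_of_ne_of_ne hac.symm hbc.symm, h₁, Function.comp_assoc]
  simp only [← Function.comp_assoc s]
  simp only [Function.comp_assoc, hs]
  exact h

theorem crossOp_comm {a b a' b' : Fin n} (h₁ : a ≠ a') (h₂ : a ≠ b') (h₃ : b ≠ a')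
    (h₄ : b ≠ b') :
    (D.crossOp a b * D.crossOp a' b' : Module.End L (States L N n)) =
      D.crossOp a' b' * D.crossOp a b := by
  refine LinearMap.ext fun φ => funext fun s => ?_
  have hs : (s ∘ Equiv.swap a b) ∘ Equiv.swap a' b' = (s ∘ Equiv.swap a' b') ∘ Equiv.swap a b := by
    rw [Function.comp_assoc, Function.comp_assoc]
    congr 1
    funext i
    simp only [Function.comp_apply, Equiv.swap_apply_def]
    grind
  simp only [Module.End.mul_apply, crossOp_apply, Function.comp_apply, hs,
    Equiv.swap_apply_of_ne_of_ne h₁ h₂, Equiv.swap_apply_of_ne_of_ne h₃ h₄,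
    Equiv.swap_apply_of_ne_of_ne h₁.symm h₃.symm, Equiv.swap_apply_of_ne_of_ne h₂.symm h₄.symm]
  ring

/-- The projection to the labellings with the strands `a` and `b` of the same colour. -/
def colourOp (a b : Fin n) : Module.End L (States L N n) :=
  mulOp fun s => sameColour L (s a) (s b)

theorem crossOp_sq (a b : Fin n) :
    (D.crossOp a b * D.crossOp a b : Module.End L (States L N n)) =
      1 + D.u • (colourOp a b * D.crossOp a b) := by
  refine LinearMap.ext fun φ => funext fun s => ?_
  have h₁ : (s ∘ Equiv.swap a b) ∘ Equiv.swap a b = s := by funext k; simp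
  have h₂ := D.diag_sq (s a) (s b)
  have h₃ := D.diag_add (s a) (s b)
  simp only [Module.End.mul_apply, crossOp_apply, Function.comp_apply, h₁, colourOp,
    Equiv.swap_apply_left, Equiv.swap_apply_right, LinearMap.add_apply, Module.End.one_apply,
    Pi.add_apply, LinearMap.smul_apply, Pi.smul_apply, smul_eq_mul, mulOp_apply]
  linear_combination φ s * h₂ + φ (s ∘ Equiv.swap a b) * h₃

/-- Together with the quadratic relation, this makes `crossOp - u • colourOp` a two-sided inverse of
the crossing. -/
theorem crossOp_commute_colourOp (a b : Fin n) :
    (colourOp a b * D.crossOp a b : Module.End L (States L N n)) =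
      D.crossOp a b * colourOp a b := by
  refine LinearMap.ext fun φ => funext fun s => ?_
  simp only [Module.End.mul_apply, crossOp_apply, Function.comp_apply, colourOp,
    Equiv.swap_apply_left, Equiv.swap_apply_right, mulOp_apply, sameColour,
    eq_comm (a := (s b).1)]
  ring

/-- The R-matrix as an invertible operator. -/
def crossUnit (a b : Fin n) : (Module.End L (States L N n))ˣ where
  val := D.crossOp a b
  inv := D.crossOp a b - D.u • colourOp a b
  val_inv := by
    rw [mul_sub, D.crossOp_sq a b, mul_smul_comm, ← D.crossOp_commute_colourOp,
      add_sub_cancel_right]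
  inv_val := by
    rw [sub_mul, D.crossOp_sq a b, smul_mul_assoc, add_sub_cancel_right]

/-- The framing operator of the strand `j`. -/
def framingOp (j : Fin n) : Module.End L (States L N n) := mulOp fun s => (D.ω (s j).1 : L)

/-- The framing operator as an invertible operator. -/
def framingUnit (j : Fin n) : (Module.End L (States L N n))ˣ where
  val := D.framingOp j
  inv := mulOp fun s => ((D.ω (s j).1)⁻¹ : Lˣ)
  val_inv := by
    refine LinearMap.ext fun φ => funext fun s => ?_
    simp [framingOp]
  inv_val := by
    refine LinearMap.ext fun φ => funext fun s => ?_
    simp [framingOp]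

theorem framingOp_pow_apply (j : Fin n) (k : ℕ) (φ : States L N n) (s : Fin n → Label N) :
    (D.framingOp j ^ k) φ s = (D.ω (s j).1 : L) ^ k * φ s := by
  induction k with
  | zero => simp
  | succ k ih =>
    rw [pow_succ', Module.End.mul_apply, framingOp, mulOp_apply, ← framingOp, ih, pow_succ']
    ring

theorem framingUnit_inv_pow_apply (j : Fin n) (k : ℕ) (φ : States L N n)
    (s : Fin n → Label N) :
    (((D.framingUnit j)⁻¹ ^ k : (Module.End L (States L N n))ˣ) : Module.End L (States L N n)) φ s
      = (((D.ω (s j).1)⁻¹ ^ k : Lˣ) : L) * φ s := by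
  induction k with
  | zero => simp
  | succ k ih =>
    rw [pow_succ', Units.val_mul, Module.End.mul_apply, pow_succ', Units.val_mul, mul_assoc, ← ih]
    rfl

/-- The images of the generators in the R-matrix representation. -/
def genOp (N : κ → ℕ) (n : ℕ) : FramedGen n → (Module.End L (States L N n))ˣ
  | FramedGen.sigma i => D.crossUnit ⟨i.1, by have := i.2; omega⟩ ⟨i.1 + 1, i.2⟩
  | FramedGen.t j => D.framingUnit j

/-- The R-matrix representation of the framed braid group. -/
def rep (N : κ → ℕ) (n : ℕ) : FramedBraidGroup d n →* (Module.End L (States L N n))ˣ :=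
  PresentedGroup.toGroup (rels := {r | FramedRel d n r}) (f := D.genOp N n) (by
    rintro _ (⟨i, j, h⟩ | ⟨i, j, h⟩ | ⟨i, j⟩ | ⟨j, i⟩ | ⟨j⟩)
    · simp only [map_mul, map_inv, FreeGroup.lift_apply_of, mul_inv_eq_one, genOp]
      rcases i with ⟨i, hi⟩
      rcases j with ⟨j, hj⟩
      refine Units.ext ?_
      simp only [Units.val_mul, crossUnit]
      rcases h with h | h <;> simp only at h <;> subst h
      · exact D.crossOp_braid (by simp) (by simp) (by simp; omega)
      · exact (D.crossOp_braid (by simp) (by simp) (by simp; omega)).symm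
    · simp only [map_mul, map_inv, FreeGroup.lift_apply_of, mul_inv_eq_one, genOp]
      refine Units.ext ?_
      simp only [Units.val_mul, crossUnit]
      refine D.crossOp_comm ?_ ?_ ?_ ?_ <;> simp only [ne_eq, Fin.mk.injEq] <;> omega
    · simp only [map_mul, map_inv, FreeGroup.lift_apply_of, mul_inv_eq_one, genOp]
      refine Units.ext (LinearMap.ext fun φ => funext fun s => ?_)
      simp only [Units.val_mul, framingUnit, Module.End.mul_apply, framingOp, mulOp_apply]
      ring
    · simp only [map_mul, map_inv, FreeGroup.lift_apply_of, mul_inv_eq_one, genOp]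
      refine Units.ext (LinearMap.ext fun φ => funext fun s => ?_)
      simp only [Units.val_mul, framingUnit, crossUnit, Module.End.mul_apply, framingOp,
        mulOp_apply, crossOp_apply, Function.comp_apply, strandSwap]
      unfold flip diag
      simp only [Equiv.swap_apply_def]
      grind
    · simp only [map_pow, FreeGroup.lift_apply_of, genOp]
      refine Units.ext (LinearMap.ext fun φ => funext fun s => ?_)
      rw [Units.val_pow_eq_pow_val]
      simp only [framingUnit]
      rw [framingOp_pow_apply, ← Units.val_pow_eq_pow_val, D.ω_pow]
      simp)

theorem rep_σ (i : Crossing n) : (D.rep N n (σ i) : Module.End L (States L N n)) =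
    D.crossOp ⟨i.1, by have := i.2; omega⟩ ⟨i.1 + 1, i.2⟩ :=
  congrArg Units.val (PresentedGroup.toGroup.of _)

theorem rep_t (j : Fin n) : D.rep N n (t j) = D.framingUnit j :=
  PresentedGroup.toGroup.of _

/-- The R-matrix representation with values in the algebra of operators. -/
def repHom (N : κ → ℕ) (n : ℕ) : FramedBraidGroup d n →* Module.End L (States L N n) :=
  (Units.coeHom _).comp (D.rep N n)

theorem repHom_σ (i : Crossing n) : D.repHom N n (σ i) =
    D.crossOp ⟨i.1, by have := i.2; omega⟩ ⟨i.1 + 1, i.2⟩ := D.rep_σ i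

theorem repHom_t (j : Fin n) : D.repHom N n (t j) = D.framingOp j :=
  congrArg Units.val (D.rep_t (N := N) j)

theorem repHom_t_pow_mul_inv_pow_apply (i j : Fin n) (k : ℕ) (φ : States L N n)
    (s : Fin n → Label N) :
    D.repHom N n (t i ^ k * (t j)⁻¹ ^ k) φ s =
      ((D.ω (s i).1 ^ k * (D.ω (s j).1)⁻¹ ^ k : Lˣ) : L) * φ s := by
  have h : D.repHom N n (t i ^ k * (t j)⁻¹ ^ k) = D.framingOp i ^ k *
      (((D.framingUnit j)⁻¹ ^ k : (Module.End L (States L N n))ˣ) : Module.End L (States L N n)) := by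
    rw [map_mul, map_pow, repHom_t]
    congr 1
    rw [repHom, MonoidHom.comp_apply, map_pow, map_inv, rep_t]
    rfl
  rw [h, Module.End.mul_apply, framingOp_pow_apply, framingUnit_inv_pow_apply]
  simp only [Units.val_mul, Units.val_pow_eq_pow_val, mul_assoc]

/-- By orthogonality, the sum over `s` of the operators of `t_i^s t_{i+1}^{-s}` is `d` times the
projector onto equal colours, and `d v = u`. -/
theorem isQuadratic_repHom : IsQuadratic D.v (D.repHom N n) := by
  intro i
  rw [map_mul, repHom_σ, D.crossOp_sq]
  congr 1
  simp only [map_mul (D.repHom N n), map_pow (D.repHom N n), ← Finset.sum_mul, repHom_σ]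
  rw [← smul_mul_assoc, ← smul_mul_assoc]
  congr 1
  refine LinearMap.ext fun φ => funext fun s => ?_
  simp only [← map_pow (D.repHom N n), ← map_mul (D.repHom N n), LinearMap.smul_apply,
    Pi.smul_apply, LinearMap.sum_apply, Finset.sum_apply, repHom_t_pow_mul_inv_pow_apply,
    ← Finset.sum_mul, D.sum_ω, colourOp, mulOp_apply, sameColour, smul_eq_mul]
  split_ifs
  · rw [← D.d_mul_v]; ring
  · ring

end RMatrixScalars

end YokonumaHecke

namespace YokonumaHecke

namespace RMatrixScalars

open FramedBraidGroup

variable {d : ℕ} {κ L : Type*} [CommRing L] [DecidableEq κ] (D : RMatrixScalars d κ L)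
  {N : κ → ℕ} {n : ℕ}

/-! ### The weighted trace -/

/-- The weight of a labelling. -/
def weight (m : Label N → L) (n : ℕ) : States L N n := fun s => ∏ k, m (s k)

omit [DecidableEq κ] in
theorem weight_comp_swap (m : Label N → L) (s : Fin n → Label N) (a b : Fin n) :
    weight m n (s ∘ Equiv.swap a b) = weight m n s :=
  Equiv.prod_comp (Equiv.swap a b) fun k => m (s k)

omit [DecidableEq κ] in
theorem weight_snoc (m : Label N → L) (s : Fin n → Label N) (x : Label N) :
    weight m (n + 1) (Fin.snoc s x) = weight m n s * m x := by
  simp [weight, Fin.prod_univ_castSucc]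

/-- A weight that is a product over the strands is unchanged when labels are permuted. This is what
makes the weighted trace cyclic on the representation. -/
theorem commute_weight_repHom (m : Label N → L) (f : FramedBraidGroup d n) :
    Commute (mulOp (weight m n)) (D.repHom N n f) := by
  induction f using induction_generators with
  | hσ i =>
    refine LinearMap.ext fun φ => funext fun s => ?_
    simp only [repHom_σ, Module.End.mul_apply, crossOp_apply, mulOp_apply, weight_comp_swap]
    ring
  | ht j =>
    refine LinearMap.ext fun φ => funext fun s => ?_
    simp only [repHom_t, Module.End.mul_apply, framingOp, mulOp_apply]
    ring
  | one => rw [map_one]; exact Commute.one_right _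
  | mul a b ha hb => rw [map_mul]; exact ha.mul_right hb
  | inv a ha =>
    have h : D.repHom N n a⁻¹ = ((D.rep N n a)⁻¹ : (Module.End L (States L N n))ˣ) := by
      rw [repHom, MonoidHom.comp_apply, map_inv]; rfl
    rw [h]
    exact Commute.units_inv_right ha

variable [Fintype κ]

/-- The trace of an operator, weighted by the labels. -/
def wtrace (m : Label N → L) (n : ℕ) : Module.End L (States L N n) →ₗ[L] L :=
  LinearMap.trace L (States L N n) ∘ₗ LinearMap.mulLeft L (mulOp (weight m n))

theorem wtrace_apply (m : Label N → L) (T : Module.End L (States L N n)) :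
    wtrace m n T = ∑ s, weight m n s * T (Pi.single s 1) s := by
  rw [wtrace, LinearMap.comp_apply, LinearMap.mulLeft_apply,
    LinearMap.trace_eq_matrix_trace L (Pi.basisFun L (Fin n → Label N)), Matrix.trace]
  refine Finset.sum_congr rfl fun s _ => ?_
  simp

omit [Fintype κ] in
theorem wtrace_mul_comm (m : Label N → L) (f g : FramedBraidGroup d n) :
    wtrace m n (D.repHom N n (f * g)) = wtrace m n (D.repHom N n (g * f)) := by
  simp only [wtrace, LinearMap.comp_apply, LinearMap.mulLeft_apply, map_mul]
  rw [← mul_assoc, LinearMap.trace_mul_comm, ← mul_assoc, ← (D.commute_weight_repHom m g).eq, mul_assoc]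

/-- Restriction to the labellings with a given last label. -/
def restrict (L : Type*) [CommRing L] (n : ℕ) (x : Label N) :
    States L N (n + 1) →ₗ[L] States L N n :=
  LinearMap.funLeft L L fun s => Fin.snoc (α := fun _ => Label N) s x

omit [DecidableEq κ] [Fintype κ] in
theorem restrict_apply (x : Label N) (φ : States L N (n + 1)) (s : Fin n → Label N) :
    restrict L n x φ s = φ (Fin.snoc s x) := rfl

omit [DecidableEq κ] [Fintype κ] in
theorem snoc_comp_swap (s : Fin n → Label N) (x : Label N) (a b : Fin n) :
    (Fin.snoc s x : Fin (n + 1) → Label N) ∘ Equiv.swap a.castSucc b.castSucc =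
      Fin.snoc (s ∘ Equiv.swap a b) x := by
  funext k
  obtain ⟨k, rfl⟩ | rfl := k.eq_castSucc_or_eq_last
  · rw [Fin.snoc_castSucc, Function.comp_apply, Function.comp_apply, Equiv.swap_apply_def,
      Equiv.swap_apply_def]
    simp only [Fin.castSucc_inj]
    split_ifs <;> rw [Fin.snoc_castSucc]
  · rw [Fin.snoc_last, Function.comp_apply, Equiv.swap_apply_of_ne_of_ne
      (Fin.castSucc_lt_last a).ne' (Fin.castSucc_lt_last b).ne', Fin.snoc_last]

omit [Fintype κ] in
theorem restrict_repHom_incl (x : Label N) (f : FramedBraidGroup d n)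
    (φ : States L N (n + 1)) :
    restrict L n x (D.repHom N (n + 1) (incl d n f) φ) = D.repHom N n f (restrict L n x φ) := by
  induction f using induction_generators generalizing φ with
  | hσ i =>
    funext s
    have h := snoc_comp_swap s x ⟨i.1, by have := i.2; omega⟩ ⟨i.1 + 1, i.2⟩
    have h₁ : (Fin.snoc s x : Fin (n + 1) → Label N) ⟨i.1, by have := i.2; omega⟩ =
      s ⟨i.1, by have := i.2; omega⟩ := Fin.snoc_castSucc (α := fun _ => Label N) x s ⟨i.1, _⟩
    have h₂ : (Fin.snoc s x : Fin (n + 1) → Label N) ⟨i.1 + 1, by have := i.2; omega⟩ =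
      s ⟨i.1 + 1, i.2⟩ := Fin.snoc_castSucc (α := fun _ => Label N) x s ⟨i.1 + 1, i.2⟩
    simp only [incl_σ, repHom_σ, crossOp_apply, restrict_apply, Crossing.castSucc, h₁, h₂, ← h]
    rfl
  | ht j =>
    funext s
    simp only [incl_t, repHom_t, framingOp, mulOp_apply, restrict_apply, Fin.snoc_castSucc]
  | one => simp
  | mul a b ha hb => simp only [map_mul, Module.End.mul_apply, ha, hb]
  | inv a ha =>
    have h := ha (D.repHom N (n + 1) (incl d n a⁻¹) φ)
    rw [← Module.End.mul_apply, ← map_mul, ← map_mul, mul_inv_cancel, map_one, map_one,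
      Module.End.one_apply] at h
    rw [h, ← Module.End.mul_apply, ← map_mul, inv_mul_cancel, map_one, Module.End.one_apply]

/-- A partial trace over the last strand. By `hw`, the block of `S` with last label `x` at both
input and output is diagonal with entries `w s x`; by `hz`, the weighted sum of these blocks is the
scalar `z`. The operator of `f` does not touch the last label, so the scalar factors out. -/
theorem wtrace_incl_mul (m : Label N → L) (f : FramedBraidGroup d n)
    (S : Module.End L (States L N (n + 1))) (w : (Fin n → Label N) → Label N → L) (z : L)
    (hw : ∀ s x, restrict L n x (S (Pi.single (Fin.snoc s x) 1)) = w s x • Pi.single s 1)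
    (hz : ∀ s, ∑ x, m x * w s x = z) :
    wtrace m (n + 1) (D.repHom N (n + 1) (incl d n f) * S) =
      z * wtrace m n (D.repHom N n f) := by
  rw [wtrace_apply, wtrace_apply, ← (Fin.snocEquiv fun _ => Label N).sum_comp,
    Fintype.sum_prod_type_right, Finset.mul_sum]
  refine Finset.sum_congr rfl fun s _ => ?_
  rw [← hz s, Finset.sum_mul]
  refine Finset.sum_congr rfl fun x _ => ?_
  change weight m (n + 1) (Fin.snoc s x) * restrict L n x
    ((D.repHom N (n + 1) (incl d n f) * S) (Pi.single (Fin.snoc s x) 1)) s = _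
  rw [Module.End.mul_apply, restrict_repHom_incl, hw, map_smul, Pi.smul_apply,
    smul_eq_mul, weight_snoc]
  ring

theorem wtrace_incl_mul_t_pow (m : Label N → L) (f : FramedBraidGroup d n) (k : ℕ) :
    wtrace m (n + 1) (D.repHom N (n + 1) (incl d n f * t (Fin.last n) ^ k)) =
      (∑ x, m x * (D.ω x.1 : L) ^ k) * wtrace m n (D.repHom N n f) := by
  rw [map_mul]
  refine D.wtrace_incl_mul m f _ (fun _ x => (D.ω x.1 : L) ^ k) _ (fun s x => ?_) fun s => rfl
  funext s'
  simp only [map_pow, repHom_t, restrict_apply, framingOp_pow_apply, Fin.snoc_last,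
    Pi.smul_apply, smul_eq_mul, Pi.single_apply, Fin.snoc_inj, and_true]

theorem wtrace_incl_mul_σ (m : Label N → L) (f : FramedBraidGroup d (n + 1)) (z : L)
    (hz : ∀ y : Label N, ∑ x, m x * D.diag y x = z) :
    wtrace m (n + 2) (D.repHom N (n + 2) (incl d (n + 1) f * σ (Crossing.last n))) =
      z * wtrace m (n + 1) (D.repHom N (n + 1) f) := by
  rw [map_mul]
  refine D.wtrace_incl_mul m f _ (fun s x => D.diag (s (Fin.last n)) x) _ (fun s x => ?_)
    fun s => hz _
  funext s'
  have h₁ : (Fin.snoc s' x : Fin (n + 2) → Label N) ⟨n, by omega⟩ = s' (Fin.last n) :=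
    Fin.snoc_castSucc (α := fun _ => Label N) x s' (Fin.last n)
  have h₂ : (Fin.snoc s' x : Fin (n + 2) → Label N) ⟨n + 1, by omega⟩ = x :=
    Fin.snoc_last (α := fun _ => Label N) x s'
  -- The flip can preserve the last label only when the last two labels coincide, and there its
  -- coefficient is zero.
  have h₃ : (Fin.snoc s' x : Fin (n + 2) → Label N) ∘ Equiv.swap ⟨n, by omega⟩ ⟨n + 1, by omega⟩ =
      Fin.snoc s x → s' (Fin.last n) = x := fun h => by
    have h₄ := congrFun h ⟨n + 1, by omega⟩
    rw [Function.comp_apply, Equiv.swap_apply_right, h₁] at h₄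
    exact h₄.trans (Fin.snoc_last (α := fun _ => Label N) x s)
  simp only [restrict_apply, repHom_σ, crossOp_apply, Crossing.last, h₁, h₂, Pi.smul_apply,
    smul_eq_mul, Pi.single_apply, Fin.snoc_inj, and_true]
  have h₅ : flip L (s' (Fin.last n)) x * (if (Fin.snoc s' x : Fin (n + 2) → Label N) ∘
      Equiv.swap ⟨n, by omega⟩ ⟨n + 1, by omega⟩ = Fin.snoc s x then 1 else 0) = 0 := by
    split_ifs with h
    · rw [h₃ h, flip, if_pos ⟨rfl, rfl⟩, zero_mul]
    · rw [mul_zero]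
  rw [h₅, add_zero]
  split_ifs with h
  · rw [h]
  · rw [mul_zero, mul_zero]

/-! ### The weights of the Markov trace -/

/-- The weights for which the weighted trace is a Markov trace with parameter `z`. -/
def markovWeight (z : L) (x : Label N) : L := z * (D.q - D.u) ^ (2 * (x.2 : ℕ) + 1)

/-- The total weight of `k` labels of the same colour. -/
def totalWeight (z : L) (k : ℕ) : L := ∑ j ∈ Finset.range k, z * (D.q - D.u) ^ (2 * j + 1)

/-- This explains the choice of weights. Only labels of the colour of `y` contribute, and if `y` has
number `i` the sum is `z` times `q·q^{-(2i+1)} + ∑_{j<i} u q^{-(2j+1)}`. Since `q - u = q⁻¹`, this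
expression does not change when `i` increases and equals `1`. -/
theorem sum_markovWeight_mul_diag (z : L) (y : Label N) :
    ∑ x, D.markovWeight z x * D.diag y x = z := by
  have hq : D.q * (D.q - D.u) = 1 := by linear_combination D.q_sq
  have key : ∀ i : ℕ, D.q * (D.q - D.u) ^ (2 * i + 1) +
      ∑ j ∈ Finset.range i, D.u * (D.q - D.u) ^ (2 * j + 1) = 1 := by
    intro i
    induction i with
    | zero => simpa using hq
    | succ i ih =>
      rw [Finset.sum_range_succ]
      linear_combination ih + (D.q - D.u) ^ (2 * i + 2) * hq
  rw [Fintype.sum_sigma, Finset.sum_eq_single y.1]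
  · simp only [markovWeight, diag, if_true]
    rw [← Finset.sum_range fun j => z * (D.q - D.u) ^ (2 * j + 1) *
      if (y.2 : ℕ) = j then D.q else if j < y.2 then D.u else 0]
    rw [← Finset.sum_subset (Finset.range_subset_range.mpr y.2.isLt), Finset.sum_range_succ,
      if_pos rfl]
    · refine Eq.trans ?_ ((congrArg (z * ·) (key y.2)).trans (mul_one z))
      rw [mul_add, Finset.mul_sum, add_comm]
      congr 1
      · ring
      · refine Finset.sum_congr rfl fun j hj => ?_
        have := Finset.mem_range.mp hj
        rw [if_neg (by omega), if_pos this]; ring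
    · intro j _ hj
      have := mt Finset.mem_range.mpr hj
      rw [if_neg (by omega), if_neg (by omega), mul_zero]
  · intro c _ hc
    refine Finset.sum_eq_zero fun j _ => ?_
    rw [diag, if_neg hc.symm, mul_zero]
  · simp

theorem sum_markovWeight_mul_ω (z : L) (k : ℕ) :
    ∑ x : Label N, D.markovWeight z x * (D.ω x.1 : L) ^ k =
      ∑ c, D.totalWeight z (N c) * (D.ω c : L) ^ k := by
  rw [Fintype.sum_sigma]
  refine Finset.sum_congr rfl fun c _ => ?_
  rw [totalWeight, Finset.sum_mul, Finset.sum_range]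
  rfl

end RMatrixScalars

end YokonumaHecke

namespace YokonumaHecke

open FramedBraidGroup

/-! ### Linear functionals on the Yokonuma–Hecke algebra -/

namespace YHAlgebra

variable {d : ℕ} {q : ℂ} {n : ℕ} {M : Type*} [AddCommGroup M] [Module ℂ M]

/-- The linear extension of a function on a monoid to the monoid algebra. -/
def extend {G : Type*} [Monoid G] (φ : G → M) : MonoidAlgebra ℂ G →ₗ[ℂ] M :=
  Finsupp.linearCombination ℂ φ ∘ₗ
    { toFun := MonoidAlgebra.coeff, map_add' := fun _ _ => rfl, map_smul' := fun _ _ => rfl }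

theorem extend_of {G : Type*} [Monoid G] (φ : G → M) (f : G) :
    extend φ (MonoidAlgebra.of ℂ G f) = φ f := by
  change Finsupp.linearCombination ℂ φ (Finsupp.single f 1) = _
  rw [Finsupp.linearCombination_single, one_smul]

/-- A linear functional on the group algebra that respects the quadratic relations descends to
the Yokonuma–Hecke algebra. -/
theorem exists_linearMap_ofFramed (φ : FramedBraidGroup d n → M)
    (h : ∀ (f g : FramedBraidGroup d n) (i : Crossing n), φ (f * (σ i * σ i) * g) = φ (f * g) +
      ((q - q⁻¹) / d) • ∑ s ∈ Finset.Icc 1 d, φ (f * (FramedBraidGroup.t ⟨i.1, by have := i.2; omega⟩ ^ s *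
        (FramedBraidGroup.t ⟨i.1 + 1, i.2⟩)⁻¹ ^ s * σ i) * g)) :
    ∃ ψ : YHAlgebra d q n →ₗ[ℂ] M, ∀ f, ψ (ofFramed d q f) = φ f := by
  -- Two elements are congruent when the functional cannot separate their two-sided multiples. This
  -- is a ring congruence on whose classes the functional is constant, so it is enough that it
  -- contains the quadratic relations.
  let c : RingCon (MonoidAlgebra ℂ (FramedBraidGroup d n)) :=
    { r := fun x y => ∀ a b, extend φ (a * x * b) = extend φ (a * y * b)
      iseqv := ⟨fun _ _ _ => rfl, fun h a b => (h a b).symm,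
        fun h h' a b => (h a b).trans (h' a b)⟩
      mul' := fun {w x y z} h h' a b => by
        have h₁ := h a (y * b)
        have h₂ := h' (a * x) b
        simp only [mul_assoc] at h₁ h₂ ⊢
        exact h₁.trans h₂
      add' := fun {w x y z} h h' a b => by
        simp only [mul_add, add_mul, map_add, h a b, h' a b] }
  have hc : ∀ x y, c x y → extend φ x = extend φ y := fun x y h => by simpa using h 1 1
  have hrel : ∀ ⦃x y⦄, QuadRel d q n x y → c.mk' x = c.mk' y := by
    rintro _ _ ⟨i⟩
    refine (RingCon.eq c).mpr fun a b => ?_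
    induction a using MonoidAlgebra.induction_on with
    | add x y hx hy => simp only [add_mul, map_add, hx, hy]
    | smul r x hx => simp only [smul_mul_assoc, map_smul, hx]
    | of f =>
      induction b using MonoidAlgebra.induction_on with
      | add x y hx hy => simp only [mul_add, map_add, hx, hy]
      | smul r x hx => simp only [mul_smul_comm, map_smul, hx]
      | of g =>
        have h₁ := h f g i
        simp only [eElt, pow_two, smul_mul_assoc, Finset.sum_mul, mul_add, add_mul, mul_one,
          mul_smul_comm, Finset.mul_sum, ← map_mul, map_add, map_smul, map_sum, extend_of, h₁,
          smul_smul, mul_one_div]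
  have hmk : ∀ x y, RingQuot.mkAlgHom ℂ (QuadRel d q n) x = RingQuot.mkAlgHom ℂ _ y →
      extend φ x = extend φ y := fun x y hxy => by
    refine hc x y ((RingCon.eq c).mp ?_)
    have h₁ := congrArg (RingQuot.lift ⟨c.mk', hrel⟩) hxy
    rw [← AlgHom.coe_toRingHom, RingQuot.mkAlgHom_coe] at h₁
    simp only [RingQuot.lift_mkRingHom_apply] at h₁
    exact h₁
  let p := (RingQuot.mkAlgHom ℂ (QuadRel d q n)).toLinearMap
  have hp : Function.Surjective p := RingQuot.mkAlgHom_surjective ℂ (QuadRel d q n)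
  refine ⟨(LinearMap.ker p).liftQ (extend φ) (fun x hx => ?_) ∘ₗ
    (p.quotKerEquivOfSurjective hp).symm.toLinearMap, fun f => ?_⟩
  · rw [LinearMap.mem_ker, ← map_zero (extend φ)]
    exact hmk x 0 (by rw [map_zero]; exact hx)
  · have h₁ : ofFramed d q f =
        p.quotKerEquivOfSurjective hp (Submodule.Quotient.mk (MonoidAlgebra.of ℂ _ f)) := rfl
    rw [LinearMap.comp_apply, h₁, LinearEquiv.coe_coe, LinearEquiv.symm_apply_apply,
      Submodule.liftQ_apply, extend_of]

end YHAlgebra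

/-! ### The generic trace -/

namespace RMatrixScalars

open MvPolynomial (eval)

variable {d : ℕ} {κ L : Type*} [CommRing L] [DecidableEq κ] [Fintype κ]
  (D : RMatrixScalars d κ L) (z : L) {n : ℕ}

/-- The trace of the R-matrix representations is polynomial in the total weights of the
colours. -/
theorem exists_tracePoly [NeZero d] (n : ℕ) (f : FramedBraidGroup d n) :
    ∃ P : MvPolynomial κ L, ∀ N : κ → ℕ, eval (fun c => D.totalWeight z (N c)) P =
      wtrace (D.markovWeight z) n (D.repHom N n f) := by
  induction n with
  | zero =>
    refine ⟨1, fun N => ?_⟩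
    rw [eq_one_of_zero f, map_one, map_one, wtrace_apply]
    simp [weight]
  | succ n ih =>
    -- All choices of `N` are treated at once: the product of the operator algebras is an algebra
    -- over the polynomials in the total weights, each factor through its own evaluation. The
    -- spanning theorem over this coefficient ring then gives coefficients independent of `N`.
    let B := ∀ N : κ → ℕ, Module.End L (States L N (n + 1))
    let φ : MvPolynomial κ L →+* B := RingHom.pi fun N =>
      (algebraMap L (Module.End L (States L N (n + 1)))).comp
        (eval fun c => D.totalWeight z (N c))
    let _ : Algebra (MvPolynomial κ L) B := φ.toAlgebra' fun c x => funext fun N =>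
      Algebra.commutes (eval (fun c => D.totalWeight z (N c)) c) (x N)
    have hsmul : ∀ (c : MvPolynomial κ L) (x : B) (N : κ → ℕ), (c • x) N =
        eval (fun c => D.totalWeight z (N c)) c • x N := fun c x N =>
      (Algebra.smul_def (eval (fun c => D.totalWeight z (N c)) c) (x N)).symm
    let θ : FramedBraidGroup d (n + 1) →* B := MonoidHom.pi fun N => D.repHom N (n + 1)
    have hθ : IsQuadratic (MvPolynomial.C D.v : MvPolynomial κ L) θ := by
      intro i
      funext N
      rw [Pi.add_apply, hsmul, MvPolynomial.eval_C, Finset.sum_apply]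
      exact D.isQuadratic_repHom i
    have hf := mem_markovSpan n θ hθ f
    change ∃ P : MvPolynomial κ L, ∀ N : κ → ℕ, eval (fun c => D.totalWeight z (N c)) P =
      wtrace (D.markovWeight z) (n + 1) (θ f N)
    generalize θ f = x at hf
    induction hf using Submodule.span_induction with
    | mem x hx =>
      obtain ⟨a, s, rfl⟩ | ⟨a, b, i, hi, rfl⟩ := hx
      · obtain ⟨P, hP⟩ := ih a
        refine ⟨(∑ c, MvPolynomial.X c * MvPolynomial.C ((D.ω c : L) ^ s)) * P, fun N => ?_⟩
        change _ = wtrace _ _ (D.repHom N (n + 1) _)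
        rw [wtrace_incl_mul_t_pow, sum_markovWeight_mul_ω, map_mul, hP, map_sum]
        simp only [map_mul, MvPolynomial.eval_X, MvPolynomial.eval_C]
      · obtain ⟨m, rfl⟩ : ∃ l, n = l + 1 := ⟨i.1, hi.symm⟩
        obtain rfl : i = Crossing.last m := Subtype.ext (Nat.succ.inj hi)
        obtain ⟨P, hP⟩ := ih (b * a)
        refine ⟨MvPolynomial.C z * P, fun N => ?_⟩
        change _ = wtrace _ _ (D.repHom N (m + 2) _)
        rw [wtrace_mul_comm, ← mul_assoc, ← map_mul,
          D.wtrace_incl_mul_σ _ _ z (D.sum_markovWeight_mul_diag z), map_mul, hP,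
          MvPolynomial.eval_C]
    | zero => exact ⟨0, fun N => by rw [Pi.zero_apply, map_zero, map_zero]⟩
    | add x y _ _ hx hy =>
      obtain ⟨P, hP⟩ := hx
      obtain ⟨Q, hQ⟩ := hy
      exact ⟨P + Q, fun N => by rw [Pi.add_apply, map_add, map_add, hP, hQ]⟩
    | smul c x _ hx =>
      obtain ⟨P, hP⟩ := hx
      exact ⟨c * P, fun N => by rw [hsmul, map_mul, map_smul, hP, smul_eq_mul]⟩

/-- The trace of the R-matrix representations, as a polynomial in the total weights of the
colours. -/
def tracePoly [NeZero d] (f : FramedBraidGroup d n) : MvPolynomial κ L :=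
  (D.exists_tracePoly z n f).choose

theorem eval_tracePoly [NeZero d] (f : FramedBraidGroup d n) (N : κ → ℕ) :
    eval (fun c => D.totalWeight z (N c)) (D.tracePoly z f) =
      wtrace (D.markovWeight z) n (D.repHom N n f) :=
  (D.exists_tracePoly z n f).choose_spec N

/-! ### Identities of trace polynomials, deduced from infinitely many total weights -/

section

variable [IsDomain L] (hz : (Set.range (D.totalWeight z)).Infinite)
include hz

omit [Fintype κ] in
-- The numbers `N c` vary independently, so the evaluation points fill a product of infinite sets,
-- on which a polynomial over a domain is determined by its values.
theorem eq_of_eval_totalWeight {P Q : MvPolynomial κ L}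
    (h : ∀ N : κ → ℕ, eval (fun c => D.totalWeight z (N c)) P =
      eval (fun c => D.totalWeight z (N c)) Q) : P = Q := by
  refine MvPolynomial.funext_set (fun _ => Set.range (D.totalWeight z)) (fun _ => hz) ?_
  intro x hx
  choose N hN using fun c => hx c (Set.mem_univ c)
  obtain rfl : (fun c => D.totalWeight z (N c)) = x := funext hN
  exact h N

variable [NeZero d]

theorem tracePoly_mul_comm (f g : FramedBraidGroup d n) :
    D.tracePoly z (f * g) = D.tracePoly z (g * f) :=
  D.eq_of_eval_totalWeight z hz fun N => by
    rw [eval_tracePoly, eval_tracePoly, wtrace_mul_comm]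

theorem tracePoly_zero (f : FramedBraidGroup d 0) : D.tracePoly z f = 1 :=
  D.eq_of_eval_totalWeight z hz fun N => by
    rw [eval_tracePoly, eq_one_of_zero f, map_one (D.repHom N 0), map_one (MvPolynomial.eval _),
      wtrace_apply]
    simp [weight]

theorem tracePoly_incl_mul_t_pow (f : FramedBraidGroup d n) (s : ℕ) :
    D.tracePoly z (incl d n f * t (Fin.last n) ^ s) =
      (∑ c, MvPolynomial.X c * MvPolynomial.C ((D.ω c : L) ^ s)) * D.tracePoly z f :=
  D.eq_of_eval_totalWeight z hz fun N => by
    rw [eval_tracePoly, wtrace_incl_mul_t_pow, sum_markovWeight_mul_ω, map_mul, eval_tracePoly,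
      map_sum]
    simp only [map_mul, MvPolynomial.eval_X, MvPolynomial.eval_C]

theorem tracePoly_incl_mul_σ (f : FramedBraidGroup d (n + 1)) :
    D.tracePoly z (incl d (n + 1) f * σ (Crossing.last n)) =
      MvPolynomial.C z * D.tracePoly z f :=
  D.eq_of_eval_totalWeight z hz fun N => by
    rw [eval_tracePoly, D.wtrace_incl_mul_σ _ _ z (D.sum_markovWeight_mul_diag z), map_mul,
      eval_tracePoly, MvPolynomial.eval_C]

/-- The quadratic relation inside an arbitrary word, as needed for the functional to descend to the
Yokonuma–Hecke algebra. -/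
theorem tracePoly_quad (f g : FramedBraidGroup d n) (i : Crossing n) :
    D.tracePoly z (f * (σ i * σ i) * g) = D.tracePoly z (f * g) + MvPolynomial.C D.v *
      ∑ s ∈ Finset.Icc 1 d, D.tracePoly z (f * (t ⟨i.1, by have := i.2; omega⟩ ^ s *
        (t ⟨i.1 + 1, i.2⟩)⁻¹ ^ s * σ i) * g) :=
  D.eq_of_eval_totalWeight z hz fun N => by
    simp only [map_add, map_mul (MvPolynomial.eval _), map_sum, eval_tracePoly, MvPolynomial.eval_C]
    rw [map_mul (D.repHom N n), map_mul (D.repHom N n), D.isQuadratic_repHom i, mul_add, add_mul, mul_one, ← map_mul, map_add,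
      mul_smul_comm, smul_mul_assoc, map_smul, smul_eq_mul, Finset.mul_sum, Finset.sum_mul, map_sum]
    simp only [← map_mul (D.repHom N n)]

end

end RMatrixScalars

end YokonumaHecke

namespace YokonumaHecke

open FramedBraidGroup

/-! ### Existence of the Markov trace -/

theorem sum_Icc_pow_of_pow_eq_one {d : ℕ} {w : ℂ} (hw : w ^ d = 1) :
    ∑ s ∈ Finset.Icc 1 d, w ^ s = if w = 1 then (d : ℂ) else 0 := by
  split_ifs with h
  · simp [h]
  · have h₁ : (∑ s ∈ Finset.Icc 1 d, w ^ s) * (w - 1) = 0 := by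
      rw [← Finset.Ico_add_one_right_eq_Icc, Finset.sum_Ico_eq_sum_range]
      simp only [pow_add, pow_one, ← Finset.mul_sum, Nat.add_sub_cancel]
      rw [mul_assoc, geom_sum_mul, hw, sub_self, mul_zero]
    exact (mul_eq_zero.mp h₁).resolve_right (sub_ne_zero.mpr h)

variable (d : ℕ) [NeZero d]

/-- The `d`-th roots of unity, indexed by the colours. -/
def colourRoot (c : ZMod d) : ℂˣ where
  val := ZMod.stdAddChar c
  inv := ZMod.stdAddChar (-c)
  val_inv := by rw [← AddChar.map_add_eq_mul, add_neg_cancel, AddChar.map_zero_eq_one]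
  inv_val := by rw [← AddChar.map_add_eq_mul, neg_add_cancel, AddChar.map_zero_eq_one]

theorem colourRoot_pow_mul_inv_pow (a b : ZMod d) (s : ℕ) :
    ((colourRoot d a ^ s * (colourRoot d b)⁻¹ ^ s : ℂˣ) : ℂ) =
      ZMod.stdAddChar (a - b) ^ s := by
  rw [← mul_pow, Units.val_pow_eq_pow_val, Units.val_mul, sub_eq_add_neg,
    AddChar.map_add_eq_mul]
  rfl

theorem stdAddChar_pow (c : ZMod d) (s : ℕ) :
    (ZMod.stdAddChar c : ℂ) ^ s = ZMod.stdAddChar ((s : ZMod d) * c) := by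
  rw [← AddChar.map_nsmul_eq_pow, nsmul_eq_mul]

/-- The scalars over the Laurent polynomials in `q`, with coefficients in `ℂ[z]`. -/
def genericScalars : RMatrixScalars d (ZMod d) (LaurentPolynomial ℂ[X]) where
  q := LaurentPolynomial.T 1
  u := LaurentPolynomial.T 1 - LaurentPolynomial.T (-1)
  v := algebraMap ℂ _ (d : ℂ)⁻¹ * (LaurentPolynomial.T 1 - LaurentPolynomial.T (-1))
  ω c := Units.map (algebraMap ℂ (LaurentPolynomial ℂ[X])).toMonoidHom (colourRoot d c)
  q_sq := by
    have h : (LaurentPolynomial.T (-1) : LaurentPolynomial ℂ[X]) * LaurentPolynomial.T 1 = 1 := by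
      rw [← LaurentPolynomial.T_add, neg_add_cancel, LaurentPolynomial.T_zero]
    linear_combination h
  d_mul_v := by
    rw [← mul_assoc, ← map_natCast (algebraMap ℂ (LaurentPolynomial ℂ[X])), ← map_mul,
      mul_inv_cancel₀ (NeZero.ne _), map_one, one_mul]
  ω_pow c := by
    have h : colourRoot d c ^ d = 1 := by
      refine Units.ext ?_
      rw [Units.val_pow_eq_pow_val]
      exact (stdAddChar_pow d c d).trans (by rw [ZMod.natCast_self, zero_mul]; simp)
    rw [← map_pow, h, map_one]
  sum_ω a b := by
    have h := sum_Icc_pow_of_pow_eq_one (d := d) (w := ZMod.stdAddChar (a - b)) (by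
      rw [stdAddChar_pow, ZMod.natCast_self, zero_mul, AddChar.map_zero_eq_one])
    simp only [← map_pow, ← map_inv, ← map_mul, Units.coe_map]
    refine (map_sum (algebraMap ℂ (LaurentPolynomial ℂ[X])) _ _).symm.trans ?_
    simp only [colourRoot_pow_mul_inv_pow]
    rw [h, apply_ite (algebraMap ℂ (LaurentPolynomial ℂ[X])), map_natCast, map_zero]
    refine if_congr ?_ rfl rfl
    rw [← AddChar.map_zero_eq_one (ZMod.stdAddChar (N := d)),
      ZMod.injective_stdAddChar.eq_iff, sub_eq_zero]

/-- The parameter `z`. -/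
def genericZ : LaurentPolynomial ℂ[X] := LaurentPolynomial.C X

theorem infinite_range_totalWeight :
    (Set.range ((genericScalars d).totalWeight genericZ)).Infinite := by
  refine Set.infinite_range_of_injective fun a b hab => ?_
  -- At `q = z = 1` every label has weight `1`, so the total weight of `k` labels becomes `k`.
  have h := congrArg (LaurentPolynomial.eval₂ (Polynomial.evalRingHom (1 : ℂ)) 1) hab
  have h₁ : ∀ k, LaurentPolynomial.eval₂ (Polynomial.evalRingHom (1 : ℂ)) 1
      ((genericScalars d).totalWeight genericZ k) = k := fun k => by
    simp [RMatrixScalars.totalWeight, genericScalars, genericZ]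
  rw [h₁, h₁] at h
  exact_mod_cast h

variable {d} {q : ℂ} (hq : q ≠ 0) (x : ZMod d → ℂ)

/-- The specialization of the generic parameters to the given ones. -/
def specialize : MvPolynomial (ZMod d) (LaurentPolynomial ℂ[X]) →+* ℂ[X] :=
  MvPolynomial.eval₂Hom
    (LaurentPolynomial.eval₂ (RingHom.id ℂ[X]) (Units.map C.toMonoidHom (Units.mk0 q hq)))
    fun c => C ((d : ℂ)⁻¹ * ∑ s : ZMod d, x s * ZMod.stdAddChar (-s * c))

theorem specialize_algebraMap (c : ℂ) :
    specialize hq x (MvPolynomial.C (algebraMap ℂ (LaurentPolynomial ℂ[X]) c)) = C c := by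
  have h : algebraMap ℂ (LaurentPolynomial ℂ[X]) c = LaurentPolynomial.C (C c) := rfl
  rw [h, specialize, MvPolynomial.eval₂Hom_C, LaurentPolynomial.eval₂_C, RingHom.id_apply]

theorem specialize_T (k : ℤ) :
    specialize hq x (MvPolynomial.C (LaurentPolynomial.T k)) = C (q ^ k) := by
  rw [specialize, MvPolynomial.eval₂Hom_C, LaurentPolynomial.eval₂_T,
    ← map_zpow (Units.map C.toMonoidHom), Units.coe_map, Units.val_zpow_eq_zpow_val]
  rfl

theorem specialize_v :
    specialize hq x (MvPolynomial.C (genericScalars d).v) = C ((q - q⁻¹) / d) := by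
  simp only [genericScalars, map_mul MvPolynomial.C, map_sub MvPolynomial.C,
    map_mul (specialize hq x), map_sub (specialize hq x), specialize_algebraMap, specialize_T]
  rw [← C_sub, ← C_mul, zpow_one, zpow_neg_one, div_eq_inv_mul]

theorem specialize_z : specialize hq x (MvPolynomial.C genericZ) = X := by
  simp [specialize, genericZ]

/-- Fourier inversion on `ZMod d`: the weights are specialized to the inverse transform of `x`, and
the sum over the colours transforms back. -/
theorem specialize_ω (s : ℕ) :
    specialize hq x (∑ c, MvPolynomial.X c * MvPolynomial.C (((genericScalars d).ω c :
      LaurentPolynomial ℂ[X]) ^ s)) = C (x s) := by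
  have hω : ∀ c, ((genericScalars d).ω c : LaurentPolynomial ℂ[X]) =
      algebraMap ℂ _ (ZMod.stdAddChar c) := fun c => rfl
  have hX : ∀ c, specialize hq x (MvPolynomial.X c) =
      C ((d : ℂ)⁻¹ * ∑ s : ZMod d, x s * ZMod.stdAddChar (-s * c)) := fun c =>
    MvPolynomial.eval₂Hom_X' _ _ _
  simp only [hω, ← map_pow (algebraMap ℂ (LaurentPolynomial ℂ[X])), map_sum (specialize hq x),
    map_mul (specialize hq x), specialize_algebraMap, hX, ← C_mul, ← map_sum C, stdAddChar_pow]
  congr 1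
  simp only [Finset.mul_sum, Finset.sum_mul]
  rw [Finset.sum_comm]
  have h : ∀ r : ZMod d, ∑ c : ZMod d, (d : ℂ)⁻¹ * (x r * ZMod.stdAddChar (-r * c)) *
      ZMod.stdAddChar ((s : ZMod d) * c) = if r = s then x r else 0 := fun r => by
    have h₁ := AddChar.sum_mulShift ((s : ZMod d) - r) (ZMod.isPrimitive_stdAddChar d)
    have h₂ : ∀ c : ZMod d, (d : ℂ)⁻¹ * (x r * ZMod.stdAddChar (-r * c)) *
        ZMod.stdAddChar ((s : ZMod d) * c) =
        (d : ℂ)⁻¹ * x r * ZMod.stdAddChar (c * ((s : ZMod d) - r)) := fun c => by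
      rw [← mul_assoc, mul_assoc _ (ZMod.stdAddChar _), ← AddChar.map_add_eq_mul]
      congr 2
      ring
    simp only [h₂, ← Finset.mul_sum, h₁, sub_eq_zero, eq_comm (a := r), ZMod.card]
    split_ifs
    · have hd : (d : ℂ) ≠ 0 := NeZero.ne _
      field_simp
    · simp
  simp only [h, Finset.sum_ite_eq', Finset.mem_univ, if_true]

include hq in
theorem exists_isMarkovTrace (hx : x 0 = 1) :
    ∃ tr : ∀ n : ℕ, YHAlgebra d q n →ₗ[ℂ] ℂ[X], IsMarkovTrace d q x tr := by
  have hz := infinite_range_totalWeight d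
  choose tr htr using fun n => YHAlgebra.exists_linearMap_ofFramed (q := q)
    (fun f : FramedBraidGroup d n => specialize hq x ((genericScalars d).tracePoly genericZ f))
    fun f g i => by
      rw [RMatrixScalars.tracePoly_quad _ _ hz, map_add, map_mul, specialize_v, map_sum,
        Polynomial.smul_eq_C_mul]
  have hframing : ∀ n a (s : ℕ), tr (n + 1) (YHAlgebra.incl d q n a *
      YHAlgebra.t d q (Fin.last n) ^ s) = C (x (s : ZMod d)) * tr n a := fun n a s => by
    induction a using YHAlgebra.induction_ofFramed with
    | of f =>
      rw [YHAlgebra.incl_ofFramed, YHAlgebra.t, ← map_pow, ← map_mul, htr, htr,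
        RMatrixScalars.tracePoly_incl_mul_t_pow _ _ hz, map_mul, specialize_ω]
    | add a b ha hb => simp only [map_add, add_mul, mul_add, ha, hb]
    | smul c a ha => simp only [map_smul, smul_mul_assoc, mul_smul_comm, ha]
  -- The framing rule with exponent `0`: adding a strand multiplies the trace by the sum of the
  -- weights, which specializes to `x 0 = 1`.
  have hcompat : ∀ n a, tr (n + 1) (YHAlgebra.incl d q n a) = tr n a := fun n a => by
    simpa [hx] using hframing n a 0
  refine ⟨tr, ⟨hcompat, fun n a b => ?_, fun n => ?_, fun n a => ?_, fun n a s _ _ =>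
    hframing n a s⟩⟩
  · induction a using YHAlgebra.induction_ofFramed with
    | of f =>
      induction b using YHAlgebra.induction_ofFramed with
      | of g =>
        rw [← map_mul, ← map_mul, htr, htr, RMatrixScalars.tracePoly_mul_comm _ _ hz]
      | add a b ha hb => simp only [map_add, add_mul, mul_add, ha, hb]
      | smul c a ha => simp only [map_smul, smul_mul_assoc, mul_smul_comm, ha]
    | add a b ha hb => simp only [map_add, add_mul, mul_add, ha, hb]
    | smul c a ha => simp only [map_smul, smul_mul_assoc, mul_smul_comm, ha]
  · induction n with
    | zero => rw [← map_one (YHAlgebra.ofFramed d q), htr,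
        RMatrixScalars.tracePoly_zero _ _ hz, map_one]
    | succ n ih => rw [← map_one (YHAlgebra.incl d q n), hcompat, ih]
  · induction a using YHAlgebra.induction_ofFramed with
    | of f =>
      change tr (n + 2) (_ * YHAlgebra.ofFramed d q (σ (Crossing.last n))) = _
      rw [YHAlgebra.incl_ofFramed, ← map_mul, htr, htr,
        RMatrixScalars.tracePoly_incl_mul_σ _ _ hz, map_mul, specialize_z]
    | add a b ha hb => simp only [map_add, add_mul, mul_add, ha, hb]
    | smul c a ha => simp only [map_smul, smul_mul_assoc, mul_smul_comm, ha]

end YokonumaHecke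

namespace YokonumaHecke

/-! ### The idempotents `e_{a,b}` -/

namespace YHAlgebra

open FramedBraidGroup (σ)

variable {d : ℕ} {q : ℂ} {n : ℕ}

/-- The element `e_{a,b} = (1/d) ∑_s t_a^s t_b^{-s}`. -/
def e (a b : Fin n) : YHAlgebra d q n :=
  (d : ℂ)⁻¹ • ∑ s ∈ Finset.Icc 1 d,
    ofFramed d q ((FramedBraidGroup.t a * (FramedBraidGroup.t b)⁻¹) ^ s)

theorem commute_t_mul_inv (a b a' b' : Fin n) :
    Commute (FramedBraidGroup.t a * (FramedBraidGroup.t b)⁻¹ : FramedBraidGroup d n)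
      (FramedBraidGroup.t a' * (FramedBraidGroup.t b')⁻¹) := by
  have h : ∀ i j : Fin n, Commute (FramedBraidGroup.t i : FramedBraidGroup d n)
    (FramedBraidGroup.t j) := FramedBraidGroup.t_comm
  exact ((h _ _).mul_right (h _ _).inv_right).mul_left
    ((h _ _).inv_left.mul_right (h _ _).inv_left.inv_right)

theorem commute_ofFramed_e {f : FramedBraidGroup d n} {a b : Fin n}
    (h : Commute f (FramedBraidGroup.t a * (FramedBraidGroup.t b)⁻¹)) :
    Commute (ofFramed d q f) (e a b) :=
  (Commute.sum_right _ _ _ fun s _ => (h.pow_right s).map (ofFramed d q)).smul_right _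

theorem commute_e_e (a b a' b' : Fin n) :
    Commute (e a b : YHAlgebra d q n) (e a' b') :=
  (Commute.sum_left _ _ _ fun s _ =>
    commute_ofFramed_e ((commute_t_mul_inv a b a' b').pow_left s)).smul_left _

theorem g_mul_e (a b : Fin n) (i : Crossing n) :
    g d q i * e (strandSwap i a) (strandSwap i b) = e a b * g d q i := by
  have h : ∀ s : ℕ, SemiconjBy (σ i : FramedBraidGroup d n)
      ((FramedBraidGroup.t (strandSwap i a) * (FramedBraidGroup.t (strandSwap i b))⁻¹) ^ s)
      ((FramedBraidGroup.t a * (FramedBraidGroup.t b)⁻¹) ^ s) := fun s => by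
    have h₁ : ∀ j, SemiconjBy (σ i : FramedBraidGroup d n)
        (FramedBraidGroup.t (strandSwap i j)) (FramedBraidGroup.t j) := fun j =>
      (FramedBraidGroup.t_mul_σ j i).symm
    exact ((h₁ a).mul_right (h₁ b).inv_right).pow_right s
  simp only [e, mul_smul_comm, smul_mul_assoc, Finset.mul_sum, Finset.sum_mul, g, ← map_mul,
    (h _).eq]

theorem t_mul_inv_pow (a b : Fin n) :
    (FramedBraidGroup.t a * (FramedBraidGroup.t b)⁻¹ : FramedBraidGroup d n) ^ d = 1 := by
  have h : Commute (FramedBraidGroup.t a : FramedBraidGroup d n) (FramedBraidGroup.t b)⁻¹ :=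
    Commute.inv_right (FramedBraidGroup.t_comm a b)
  rw [h.mul_pow, inv_pow, FramedBraidGroup.t_pow, FramedBraidGroup.t_pow, inv_one, one_mul]

/-- Multiplication by `t_a t_b⁻¹` shifts the summation index cyclically, because the `d`-th power of
this element is `1`. -/
theorem ofFramed_mul_e (a b : Fin n) :
    ofFramed d q (FramedBraidGroup.t a * (FramedBraidGroup.t b)⁻¹) * e a b = e a b := by
  rw [e, mul_smul_comm, Finset.mul_sum]
  congr 1
  simp only [← map_mul, ← pow_succ']
  have h : ∑ s ∈ Finset.range d, ofFramed d q
      ((FramedBraidGroup.t a * (FramedBraidGroup.t b)⁻¹) ^ (s + 1 + 1)) =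
      ∑ s ∈ Finset.range d, ofFramed d q
        ((FramedBraidGroup.t a * (FramedBraidGroup.t b)⁻¹) ^ (s + 1)) := by
    have h₁ := Finset.sum_range_succ' (fun s => ofFramed d q
      ((FramedBraidGroup.t a * (FramedBraidGroup.t b)⁻¹) ^ (s + 1))) d
    rw [Finset.sum_range_succ, pow_succ _ d, zero_add, t_mul_inv_pow, one_mul, pow_one] at h₁
    exact (add_right_cancel h₁).symm
  rw [← Finset.Ico_add_one_right_eq_Icc, Finset.sum_Ico_eq_sum_range,
    Finset.sum_Ico_eq_sum_range, Nat.add_sub_cancel]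
  simpa only [add_comm 1] using h

/-- Next to `e a b` the framings `t_a` and `t_b` are interchangeable, since `t_a t_b⁻¹` acts as `1`
there. -/
theorem ofFramed_pow_mul_e_trans (a b c : Fin n) (s : ℕ) :
    ofFramed d q ((FramedBraidGroup.t b * (FramedBraidGroup.t c)⁻¹) ^ s) * e a b =
      ofFramed d q ((FramedBraidGroup.t a * (FramedBraidGroup.t c)⁻¹) ^ s) * e a b := by
  induction s with
  | zero => simp
  | succ s ih =>
    have h : FramedBraidGroup.t b * (FramedBraidGroup.t c)⁻¹ *
        (FramedBraidGroup.t a * (FramedBraidGroup.t b)⁻¹) =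
        (FramedBraidGroup.t a * (FramedBraidGroup.t c)⁻¹ : FramedBraidGroup d n) := by
      rw [(commute_t_mul_inv b c a b).eq, mul_assoc, inv_mul_cancel_left]
    rw [pow_succ', map_mul, mul_assoc, ih, ← mul_assoc, ← map_mul,
      ((commute_t_mul_inv b c a c).pow_right s).eq]
    conv_lhs => rw [← ofFramed_mul_e a b, ← mul_assoc, ← map_mul, mul_assoc, h, ← pow_succ]

/-- The source of the relations among the idempotents: with `c = a` and `e a a = 1` it yields both
symmetry and idempotency. -/
theorem e_mul_e_trans (a b c : Fin n) : (e b c * e a b : YHAlgebra d q n) = e a c * e a b := by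
  have h := Finset.sum_congr (rfl : Finset.Icc 1 d = _) fun s _ =>
    ofFramed_pow_mul_e_trans (d := d) (q := q) a b c s
  rw [← Finset.sum_mul, ← Finset.sum_mul] at h
  have h₁ := congrArg (fun y => (d : ℂ)⁻¹ • y) h
  simp only [← smul_mul_assoc] at h₁
  exact h₁

variable [NeZero d]

theorem e_self (a : Fin n) : (e a a : YHAlgebra d q n) = 1 := by
  have : (d : ℂ) ≠ 0 := NeZero.ne _
  simp only [e, mul_inv_cancel, one_pow, map_one, Finset.sum_const, Nat.card_Icc,
    Nat.add_sub_cancel]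
  rw [← Nat.cast_smul_eq_nsmul ℂ, smul_smul, inv_mul_cancel₀ this, one_smul]

theorem e_symm (a b : Fin n) : (e a b : YHAlgebra d q n) = e b a := by
  have h₁ := e_mul_e_trans (d := d) (q := q) a b a
  have h₂ := e_mul_e_trans (d := d) (q := q) b a b
  rw [e_self, one_mul] at h₁ h₂
  rw [← h₁, (commute_e_e _ _ _ _).eq, h₂]

theorem e_mul_self (a b : Fin n) : (e a b * e a b : YHAlgebra d q n) = e a b := by
  have h₁ := e_mul_e_trans (d := d) (q := q) a b a
  rw [e_self, one_mul] at h₁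
  conv_lhs => rw [e_symm a b]
  rwa [e_symm a b] at h₁ ⊢

omit [NeZero d] in
theorem g_mul_g (i : Crossing n) : g d q i * g d q i = 1 + (q - q⁻¹) •
    (e ⟨i.1, by have := i.2; omega⟩ ⟨i.1 + 1, i.2⟩ * g d q i) := by
  have h := isQuadratic_ofFramed d q i
  simp only [map_mul (ofFramed d q) _ (σ i), ← Finset.sum_mul] at h
  rw [g, h, e, smul_mul_assoc, smul_smul, ← div_eq_mul_inv]
  refine congrArg (fun y => 1 + ((q - q⁻¹) / d) • (y * _)) (Finset.sum_congr rfl fun s _ => ?_)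
  rw [Commute.mul_pow]
  exact Commute.inv_right (FramedBraidGroup.t_comm _ _)

theorem g_mul_e_self (i : Crossing n) : g d q i * e ⟨i.1, by have := i.2; omega⟩ ⟨i.1 + 1, i.2⟩ =
    e ⟨i.1, by have := i.2; omega⟩ ⟨i.1 + 1, i.2⟩ * g d q i := by
  rw [← g_mul_e, strandSwap, Equiv.swap_apply_left, Equiv.swap_apply_right, e_symm]

omit [NeZero d] in
theorem incl_e (a b : Fin n) : incl d q n (e a b) = e a.castSucc b.castSucc := by
  simp only [e, map_smul, map_sum, incl_ofFramed, map_pow, map_mul, map_inv,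
    FramedBraidGroup.incl_t]

omit [NeZero d] in
theorem incl_g (i : Crossing n) : incl d q n (g d q i) = g d q i.castSucc := by
  rw [g, g, incl_ofFramed, FramedBraidGroup.incl_σ]

end YHAlgebra

end YokonumaHecke

namespace YokonumaHecke

open YHAlgebra

/-! ### The E-condition -/

theorem sum_Icc_eq_sum_zmod {d : ℕ} [NeZero d] {M : Type*} [AddCommMonoid M] (f : ZMod d → M) :
    ∑ s ∈ Finset.Icc 1 d, f s = ∑ s : ZMod d, f s := by
  obtain ⟨k, rfl⟩ : ∃ k, d = k + 1 := Nat.exists_eq_succ_of_ne_zero (NeZero.ne d)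
  rw [← Finset.Ico_add_one_right_eq_Icc, Finset.sum_Ico_eq_sum_range, Nat.add_sub_cancel]
  simp only [Nat.cast_add, Nat.cast_one]
  have h := Fintype.sum_equiv (Equiv.addLeft (1 : ZMod (k + 1))) (fun s => f (1 + s)) f fun _ => rfl
  rw [← h, Finset.sum_range]
  refine Finset.sum_congr rfl fun i _ => ?_
  congr 2
  exact Fin.cast_val_eq_self i

/-- The idempotent `e_n` on the last two strands. -/
def eLast (d : ℕ) (q : ℂ) (n : ℕ) : YHAlgebra d q (n + 2) :=
  e (Fin.last n).castSucc (Fin.last (n + 1))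

/-- The generator `g_n` braiding the last two strands. -/
def gLast (d : ℕ) (q : ℂ) (n : ℕ) : YHAlgebra d q (n + 2) := g d q (Crossing.last n)

theorem eLast_eq_sum (d : ℕ) (q : ℂ) (n : ℕ) : eLast d q n = (d : ℂ)⁻¹ • ∑ s ∈ Finset.Icc 1 d,
    incl d q (n + 1) (t d q (Fin.last n) ^ s) * t d q (Fin.last (n + 1)) ^ (d - s) := by
  rw [eLast, e]
  congr 1
  refine Finset.sum_congr rfl fun s hs => ?_
  have h : (FramedBraidGroup.t (Fin.last (n + 1)) : FramedBraidGroup d (n + 2))⁻¹ ^ s =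
      FramedBraidGroup.t (Fin.last (n + 1)) ^ (d - s) := by
    rw [inv_pow, inv_eq_iff_mul_eq_one, ← pow_add, Nat.add_sub_cancel' (Finset.mem_Icc.mp hs).2,
      FramedBraidGroup.t_pow]
  rw [Commute.mul_pow (Commute.inv_right (FramedBraidGroup.t_comm _ _)), h, map_mul, t, t,
    ← map_pow, incl_ofFramed, map_pow (FramedBraidGroup.incl d (n + 1)), FramedBraidGroup.incl_t,
    map_pow (ofFramed d q) _ (d - s)]

theorem commute_t_last_incl {d : ℕ} {q : ℂ} {n : ℕ} (a : YHAlgebra d q n) :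
    Commute (t d q (Fin.last n)) (incl d q n a) := by
  induction a using induction_ofFramed with
  | of f => rw [incl_ofFramed]; exact (FramedBraidGroup.commute_t_last_incl f).map (ofFramed d q)
  | add a b ha hb => rw [map_add]; exact ha.add_right hb
  | smul c a ha => rw [map_smul]; exact ha.smul_right c

theorem commute_gLast_incl_incl {d : ℕ} {q : ℂ} {n : ℕ} (a : YHAlgebra d q n) :
    Commute (gLast d q n) (incl d q (n + 1) (incl d q n a)) := by
  induction a using induction_ofFramed with
  | of f =>
    rw [incl_ofFramed, incl_ofFramed]
    exact (FramedBraidGroup.commute_σ_last_incl_incl f).map (ofFramed d q)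
  | add a b ha hb => rw [map_add, map_add]; exact ha.add_right hb
  | smul c a ha => rw [map_smul, map_smul]; exact ha.smul_right c

theorem commute_eLast_incl_incl {d : ℕ} {q : ℂ} {n : ℕ} (a : YHAlgebra d q n) :
    Commute (eLast d q n) (incl d q (n + 1) (incl d q n a)) := by
  rw [eLast_eq_sum]
  refine (Commute.sum_left _ _ _ fun s _ => ?_).smul_left _
  exact (((commute_t_last_incl a).pow_left s).map (incl d q (n + 1))).mul_left
    ((commute_t_last_incl _).pow_left _)

theorem gLast_mul_t_last_pow (d : ℕ) (q : ℂ) (n s : ℕ) :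
    gLast d q n * t d q (Fin.last (n + 1)) ^ s =
      incl d q (n + 1) (t d q (Fin.last n) ^ s) * gLast d q n := by
  have h := ((FramedBraidGroup.semiconjBy_σ_t_last (d := d) n).pow_right s).eq
  rw [gLast, g, t, t, ← map_pow, ← map_pow, incl_ofFramed, ← map_mul, h, map_mul,
    map_pow (FramedBraidGroup.incl d (n + 1))]

namespace IsMarkovTrace

variable {d : ℕ} {q : ℂ} [NeZero d] {x : ZMod d → ℂ} {tr : ∀ n : ℕ, YHAlgebra d q n →ₗ[ℂ] ℂ[X]}

omit [NeZero d] in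
theorem markov_gLast (h : IsMarkovTrace d q x tr) (n : ℕ) (a b : YHAlgebra d q (n + 1)) :
    tr (n + 2) (incl d q (n + 1) a * gLast d q n * incl d q (n + 1) b) =
      X * tr (n + 1) (a * b) := h.markov_mul n a b

/-- Carries the E-system from the parameters to the trace of arbitrary elements. On `a t^r` it is
the equation with index `r`, trivial for residue `0`. On `a g b` the power of the last framing
passes through `g` to the previous strand, the Markov rule removes `g`, and the induction hypothesis
applies one strand lower. -/
theorem sum_framing (h : IsMarkovTrace d q x tr) (hx : IsESolution x) (n : ℕ)
    (a : YHAlgebra d q (n + 1)) :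
    ∑ s ∈ Finset.Icc 1 d, C (x (-s)) * tr (n + 1) (a * t d q (Fin.last n) ^ s) =
      C (d * ePoly x 0) * tr (n + 1) a := by
  have hd : (d : ℂ) ≠ 0 := NeZero.ne _
  have ht : ∀ (n : ℕ) (a : YHAlgebra d q n) (r : ℕ), ∑ s ∈ Finset.Icc 1 d, C (x (-s)) *
      tr (n + 1) (incl d q n a * t d q (Fin.last n) ^ r * t d q (Fin.last n) ^ s) =
      C (d * ePoly x 0) * tr (n + 1) (incl d q n a * t d q (Fin.last n) ^ r) := by
    intro n a r
    have h₁ : ∑ s ∈ Finset.Icc 1 d, x (-s) * x (r + s) = d * ePoly x 0 * x r := by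
      rw [sum_Icc_eq_sum_zmod fun s => x (-s) * x (r + s)]
      have h₂ : ePoly x r = x r * ePoly x 0 := by
        by_cases hr : (r : ZMod d) = 0
        · rw [hr, hx.zero, one_mul]
        · exact hx.eq _ hr
      rw [mul_assoc, mul_comm (ePoly x 0), ← h₂, ePoly, ← mul_assoc, mul_one_div_cancel hd,
        one_mul]
      exact Finset.sum_congr rfl fun s _ => mul_comm _ _
    simp only [mul_assoc, ← pow_add, h.framing_pow hx.zero]
    simp only [← mul_assoc, ← C_mul, ← Finset.sum_mul, ← map_sum C, Nat.cast_add, h₁]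
  induction n with
  | zero =>
    induction a using induction_markov with
    | ht a r => exact ht 0 a r
    | hg a b i hi => exact absurd i.2 (by omega)
    | add a b ha hb => simp only [add_mul, map_add, mul_add, Finset.sum_add_distrib, ha, hb]
    | smul c a ha =>
      simp only [smul_mul_assoc, map_smul, mul_smul_comm, ← Finset.smul_sum, ha]
  | succ n ih =>
    induction a using induction_markov with
    | ht a r => exact ht (n + 1) a r
    | hg a b i hi =>
      obtain rfl : i = Crossing.last n := Subtype.ext (Nat.succ.inj hi)
      have h₁ : ∀ s : ℕ, tr (n + 2) (incl d q (n + 1) a * g d q (Crossing.last n) *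
          incl d q (n + 1) b * t d q (Fin.last (n + 1)) ^ s) =
          X * tr (n + 1) (b * a * t d q (Fin.last n) ^ s) := fun s => by
        rw [mul_assoc, ← ((commute_t_last_incl b).pow_left s).eq, ← mul_assoc,
          mul_assoc _ (g d q _), ← gLast, gLast_mul_t_last_pow, ← mul_assoc, ← map_mul,
          h.markov_gLast, h.tr_mul_comm, mul_assoc]
      simp only [h₁]
      rw [h.markov_mul, h.tr_mul_comm _ a b, mul_left_comm, ← ih, Finset.mul_sum]
      exact Finset.sum_congr rfl fun s _ => mul_left_comm _ _ _
    | add a b ha hb => simp only [add_mul, map_add, mul_add, Finset.sum_add_distrib, ha, hb]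
    | smul c a ha =>
      simp only [smul_mul_assoc, map_smul, mul_smul_comm, ← Finset.smul_sum, ha]

/-- The framing rule turns the factor `t^(d-s)` on the last strand into `x (-s)`, which leaves the
sum evaluated in `sum_framing`. -/
theorem tr_incl_mul_eLast (h : IsMarkovTrace d q x tr) (hx : IsESolution x) (n : ℕ)
    (a : YHAlgebra d q (n + 1)) :
    tr (n + 2) (incl d q (n + 1) a * eLast d q n) = C (ePoly x 0) * tr (n + 1) a := by
  have hd : (d : ℂ) ≠ 0 := NeZero.ne _
  have h₁ := h.sum_framing hx n a
  rw [eLast_eq_sum, mul_smul_comm, Finset.mul_sum, map_smul, map_sum]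
  simp only [← mul_assoc, ← map_mul, h.framing_pow hx.zero]
  rw [Finset.sum_congr rfl fun s hs => by
    rw [Nat.cast_sub (Finset.mem_Icc.mp hs).2, ZMod.natCast_self, zero_sub], h₁, smul_eq_C_mul,
    ← mul_assoc, ← C_mul, inv_mul_cancel_left₀ hd]

/-- Passing `t^(d-s)` through `g` puts it on the previous strand. Once the Markov rule has removed
`g` it cancels `t^s`, so all `d` summands are equal; the E-system plays no role. -/
theorem tr_incl_mul_eLast_mul_gLast (h : IsMarkovTrace d q x tr) (n : ℕ)
    (a : YHAlgebra d q (n + 1)) :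
    tr (n + 2) (incl d q (n + 1) a * (eLast d q n * gLast d q n)) = X * tr (n + 1) a := by
  have hd : (d : ℂ) ≠ 0 := NeZero.ne _
  have h₁ : ∀ s ∈ Finset.Icc 1 d, tr (n + 2) (incl d q (n + 1) a *
      (incl d q (n + 1) (t d q (Fin.last n) ^ s) * t d q (Fin.last (n + 1)) ^ (d - s) *
        gLast d q n)) = X * tr (n + 1) a := fun s hs => by
    have h₂ : t d q (Fin.last (n + 1)) ^ (d - s) * gLast d q n =
        gLast d q n * incl d q (n + 1) (t d q (Fin.last n) ^ (d - s)) := by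
      have h := ((FramedBraidGroup.semiconjBy_σ_t_prev (d := d) n).pow_right (d - s)).eq
      rw [gLast, g, t, t, ← map_pow, ← map_pow, incl_ofFramed, ← map_mul, ← h, map_mul,
        map_pow (FramedBraidGroup.incl d (n + 1))]
    rw [mul_assoc, h₂, ← mul_assoc, ← mul_assoc, ← map_mul, h.markov_gLast, mul_assoc,
      ← pow_add, Nat.add_sub_cancel' (Finset.mem_Icc.mp hs).2, t_pow, mul_one]
  rw [eLast_eq_sum, smul_mul_assoc, mul_smul_comm, Finset.sum_mul, Finset.mul_sum, map_smul,
    map_sum, Finset.sum_congr rfl h₁, Finset.sum_const, Nat.card_Icc, Nat.add_sub_cancel,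
    ← Nat.cast_smul_eq_nsmul ℂ, smul_smul, inv_mul_cancel₀ hd, one_smul]

end IsMarkovTrace

end YokonumaHecke

namespace YokonumaHecke

open YHAlgebra

/-! ### The subalgebra generated by the elements `g_i` and `e_i` -/

section Ring

variable {B : Type*} [Ring B] [Algebra ℂ B]

/-- The relations between the braids `g₁, g₂` and the idempotents `e₁, e₂` on three strands; `f`
is the idempotent of the first and the third strand. -/
structure BTRelations (u : ℂ) (g₁ g₂ e₁ e₂ f : B) : Prop where
  quad : g₂ * g₂ = 1 + u • (e₂ * g₂)
  braid : g₂ * g₁ * g₂ = g₁ * g₂ * g₁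
  idem : e₂ * e₂ = e₂
  ge₁ : g₁ * e₁ = e₁ * g₁
  ge₂ : g₂ * e₂ = e₂ * g₂
  quad₁ : g₁ * g₁ = 1 + u • (e₁ * g₁)
  ee : e₂ * e₁ = e₁ * e₂
  g₂e₁ : g₂ * e₁ = f * g₂
  g₂f : g₂ * f = e₁ * g₂
  g₁f : g₁ * f = e₂ * g₁
  g₁e₂ : g₁ * e₂ = f * g₁
  ef₁ : e₁ * f = e₁ * e₂
  ef₂ : e₂ * f = e₁ * e₂
  fe₁ : f * e₁ = e₁ * e₂
  fe₂ : f * e₂ = e₁ * e₂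

/-- The span of the products `p y q` with `p, q` in a subalgebra and `y` one of `1`, `g`, `e`,
`e g`. -/
def btSpan (P : Subalgebra ℂ B) (g e : B) : Submodule ℂ B :=
  Submodule.span ℂ {z | ∃ p ∈ P, ∃ y ∈ ({1, g, e, e * g} : Set B), ∃ r ∈ P, z = p * y * r}

variable {P : Subalgebra ℂ B} {g e : B}

theorem mem_btSpan {p y r : B} (hp : p ∈ P) (hy : y ∈ ({1, g, e, e * g} : Set B)) (hr : r ∈ P) :
    p * y * r ∈ btSpan P g e := Submodule.subset_span ⟨p, hp, y, hy, r, hr, rfl⟩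

theorem mul_mem_btSpan {p x : B} (hp : p ∈ P) (hx : x ∈ btSpan P g e) : p * x ∈ btSpan P g e := by
  refine (mem_leftStabilizer_span (A := ℂ) ?_ : p ∈ leftStabilizer (btSpan P g e)) x hx
  rintro _ ⟨p', hp', y, hy, r, hr, rfl⟩
  rw [← mul_assoc, ← mul_assoc]
  exact mem_btSpan (P.mul_mem hp hp') hy hr

theorem mem_btSpan_mul {r x : B} (hr : r ∈ P) (hx : x ∈ btSpan P g e) : x * r ∈ btSpan P g e := by
  induction hx using Submodule.span_induction with
  | mem x hx =>
    obtain ⟨p, hp, y, hy, r', hr', rfl⟩ := hx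
    rw [mul_assoc]
    exact mem_btSpan hp hy (P.mul_mem hr' hr)
  | zero => rw [zero_mul]; exact Submodule.zero_mem _
  | add x x' _ _ hx hx' => rw [add_mul]; exact Submodule.add_mem _ hx hx'
  | smul c x _ hx => rw [smul_mul_assoc]; exact Submodule.smul_mem _ _ hx

theorem mem_btSpan_of_mem {y : B} (hy : y ∈ ({1, g, e, e * g} : Set B)) : y ∈ btSpan P g e := by
  simpa using mem_btSpan P.one_mem hy P.one_mem

theorem mul_mem_btSpan_of_quad {u : ℂ} (quad : g * g = 1 + u • (e * g)) (idem : e * e = e)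
    (ge : g * e = e * g) {x y : B} (hx : x ∈ ({g, e} : Set B))
    (hy : y ∈ ({1, g, e, e * g} : Set B)) : x * y ∈ btSpan P g e := by
  have h1 : (1 : B) ∈ btSpan P g e := mem_btSpan_of_mem (by simp)
  have hg : g ∈ btSpan P g e := mem_btSpan_of_mem (by simp)
  have he : e ∈ btSpan P g e := mem_btSpan_of_mem (by simp)
  have heg : e * g ∈ btSpan P g e := mem_btSpan_of_mem (by simp)
  rcases hx with rfl | rfl <;> rcases hy with rfl | rfl | rfl | rfl
  · rwa [mul_one]
  · rw [quad]; exact add_mem h1 (Submodule.smul_mem _ _ heg)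
  · rwa [ge]
  · rw [← mul_assoc, ge, mul_assoc, quad, mul_add, mul_smul_comm, ← mul_assoc, idem, mul_one]
    exact add_mem he (Submodule.smul_mem _ _ heg)
  · rwa [mul_one]
  · exact heg
  · rwa [idem]
  · rwa [← mul_assoc, idem]

/-- The products on three strands that would use the last strand twice. The delicate one is `g₂ e₁
g₂ = f g₂² = f + u e₁ e₂ g₂`, which produces the idempotent `f` of the outer strands; `h₇` rewrites
it as `g₁ e₂ g₁ - u e₁ e₂ g₁`, where the last strand enters through single factors `e₂`. -/
theorem BTRelations.mul_mul_mem {u : ℂ} {g₁ g₂ e₁ e₂ f : B} (h : BTRelations u g₁ g₂ e₁ e₂ f)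
    (hg₁ : g₁ ∈ P) (he₁ : e₁ ∈ P) {x y' y : B} (hx : x ∈ ({g₂, e₂} : Set B))
    (hy' : y' ∈ ({1, g₁, e₁, e₁ * g₁} : Set B)) (hy : y ∈ ({1, g₂, e₂, e₂ * g₂} : Set B)) :
    x * y' * y ∈ btSpan P g₂ e₂ := by
  have one := P.one_mem
  have heg₁ := P.mul_mem he₁ hg₁
  have hge₁ := P.mul_mem hg₁ he₁
  have hg : ∀ {p r : B}, p ∈ P → r ∈ P → p * g₂ * r ∈ btSpan P g₂ e₂ :=
    fun hp hr => mem_btSpan hp (by simp) hr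
  have he : ∀ {p r : B}, p ∈ P → r ∈ P → p * e₂ * r ∈ btSpan P g₂ e₂ :=
    fun hp hr => mem_btSpan hp (by simp) hr
  have heg : ∀ {p r : B}, p ∈ P → r ∈ P → p * (e₂ * g₂) * r ∈ btSpan P g₂ e₂ :=
    fun hp hr => mem_btSpan hp (by simp) hr
  have hxy : ∀ {x y : B}, x ∈ ({g₂, e₂} : Set B) → y ∈ ({1, g₂, e₂, e₂ * g₂} : Set B) →
      x * y ∈ btSpan P g₂ e₂ := fun hx hy => mul_mem_btSpan_of_quad h.quad h.idem h.ge₂ hx hy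
  have h₁ : e₂ * g₁ * e₂ = e₁ * e₂ * g₁ := by
    rw [mul_assoc, h.g₁e₂, ← mul_assoc, h.ef₂]
  have h₂ : e₂ * g₁ * g₂ = g₁ * g₂ * e₁ := by
    rw [← h.g₁f, mul_assoc, ← h.g₂e₁, mul_assoc]
  have h₃ : g₂ * g₁ * e₂ = e₁ * g₂ * g₁ := by
    rw [mul_assoc, h.g₁e₂, ← mul_assoc, h.g₂f]
  have h₄ : e₁ * e₂ * g₁ = g₁ * e₁ * e₂ := by
    rw [mul_assoc, ← h.g₁f, ← mul_assoc, ← h.ge₁, mul_assoc, h.ef₁, ← mul_assoc]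
  have h₅ : g₂ * e₁ * e₂ = e₁ * (g₂ * e₂) := by
    rw [h.g₂e₁, mul_assoc, h.ge₂, ← mul_assoc, h.fe₂, mul_assoc]
  have h₆ : g₂ * e₁ * g₁ * e₂ = e₁ * (e₂ * g₂) * g₁ := by
    rw [h.g₂e₁, mul_assoc f, mul_assoc, h₃, mul_assoc e₁, ← mul_assoc, h.fe₁]
    simp only [mul_assoc]
  have h₇ : f = g₁ * e₂ * g₁ - u • (e₁ * e₂ * g₁) := by
    rw [h.g₁e₂, mul_assoc, h.quad₁, mul_add, mul_one, mul_smul_comm, ← mul_assoc, h.fe₁,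
      add_sub_cancel_right]
  have hA : ∀ {y}, y ∈ ({1, g₂, e₂, e₂ * g₂} : Set B) → e₂ * g₁ * y ∈ btSpan P g₂ e₂ := by
    rintro y (rfl | rfl | rfl | rfl)
    · simpa using he one hg₁
    · rw [h₂]; exact hg hg₁ he₁
    · rw [h₁]; exact he he₁ hg₁
    · rw [← mul_assoc, h₁, h₄, mul_assoc, ← mul_one (_ * (_ * _))]
      exact heg hge₁ one
  rcases hx with rfl | rfl
  · rcases hy' with rfl | rfl | rfl | rfl
    · rw [mul_one]; exact hxy (by simp) hy
    · rcases hy with rfl | rfl | rfl | rfl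
      · simpa using hg one hg₁
      · rw [h.braid]; exact hg hg₁ hg₁
      · rw [h₃]; exact hg he₁ hg₁
      · rw [← mul_assoc, h₃, mul_assoc, mul_assoc, ← mul_assoc x, h.braid, ← mul_assoc,
          ← mul_assoc]
        exact hg heg₁ hg₁
    · rcases hy with rfl | rfl | rfl | rfl
      · simpa using hg one he₁
      · rw [h.g₂e₁, mul_assoc, h.quad, mul_add, mul_one, mul_smul_comm, ← mul_assoc, h.fe₂,
          mul_assoc]
        refine add_mem ?_ (Submodule.smul_mem _ _ ?_)
        · rw [h₇]
          exact sub_mem (he hg₁ hg₁) (Submodule.smul_mem _ _ (he he₁ hg₁))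
        · simpa using heg he₁ one
      · rw [h₅]; exact mul_mem_btSpan he₁ (hxy (by simp) (by simp))
      · rw [← mul_assoc, h₅, mul_assoc, mul_assoc]
        exact mul_mem_btSpan he₁ (hxy (by simp) (by simp))
    · rw [← mul_assoc]
      rcases hy with rfl | rfl | rfl | rfl
      · simpa [mul_assoc] using hg one heg₁
      · rw [h.g₂e₁, mul_assoc f, mul_assoc, h.braid, ← mul_assoc, ← mul_assoc, ← h.g₁e₂,
          mul_assoc g₁]
        exact heg hg₁ hg₁
      · rw [h₆]; exact heg he₁ hg₁
      · rw [← mul_assoc, h₆, ← mul_assoc e₁, mul_assoc _ g₁, mul_assoc _ x, ← mul_assoc x,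
          h.braid, ← mul_assoc, ← mul_assoc, h₄, mul_assoc _ e₂]
        exact heg hge₁ hg₁
  · rcases hy' with rfl | rfl | rfl | rfl
    · rw [mul_one]; exact hxy (by simp) hy
    · exact hA hy
    · rw [h.ee, mul_assoc]; exact mul_mem_btSpan he₁ (hxy (by simp) hy)
    · rw [← mul_assoc, h.ee, mul_assoc, mul_assoc, ← mul_assoc x]
      exact mul_mem_btSpan he₁ (hA hy)

end Ring

end YokonumaHecke

namespace YokonumaHecke

open YHAlgebra

/-! ### The reduction on the last strand inside the Yokonuma–Hecke algebra -/

section BT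

variable {d : ℕ} [NeZero d] {q : ℂ}

theorem btRelations (d : ℕ) [NeZero d] (q : ℂ) (j : ℕ) :
    BTRelations (q - q⁻¹) (incl d q (j + 2) (gLast d q j)) (gLast d q (j + 1))
      (incl d q (j + 2) (eLast d q j)) (eLast d q (j + 1))
      (e (⟨j, by omega⟩ : Fin (j + 3)) ⟨j + 2, by omega⟩) := by
  have he₁ : incl d q (j + 2) (eLast d q j) = e (⟨j, by omega⟩ : Fin (j + 3)) ⟨j + 1, by omega⟩ :=
    incl_e _ _
  have he₂ : eLast d q (j + 1) = e (⟨j + 1, by omega⟩ : Fin (j + 3)) ⟨j + 2, by omega⟩ := rfl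
  have hg₁ : incl d q (j + 2) (gLast d q j) = g d q (Crossing.last j).castSucc := incl_g _
  have quad : ∀ k, gLast d q k * gLast d q k = 1 + (q - q⁻¹) • (eLast d q k * gLast d q k) :=
    fun k => g_mul_g (Crossing.last k)
  have ge : ∀ k, gLast d q k * eLast d q k = eLast d q k * gLast d q k :=
    fun k => g_mul_e_self (Crossing.last k)
  have hs₁ : strandSwap (Crossing.last j).castSucc = Equiv.swap (⟨j, by omega⟩ : Fin (j + 3))
    ⟨j + 1, by omega⟩ := rfl
  have hs₂ : strandSwap (Crossing.last (j + 1)) = Equiv.swap (⟨j + 1, by omega⟩ : Fin (j + 3))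
    ⟨j + 2, by omega⟩ := rfl
  have n₁ : (⟨j, by omega⟩ : Fin (j + 3)) ≠ ⟨j + 1, by omega⟩ := by simp
  have n₂ : (⟨j, by omega⟩ : Fin (j + 3)) ≠ ⟨j + 2, by omega⟩ := by simp
  have n₃ : (⟨j + 1, by omega⟩ : Fin (j + 3)) ≠ ⟨j + 2, by omega⟩ := by simp
  have m₁ := fun a b => g_mul_e (d := d) (q := q) a b (Crossing.last j).castSucc
  have m₂ := fun a b => g_mul_e (d := d) (q := q) a b (Crossing.last (j + 1))
  rw [hs₁] at m₁
  rw [hs₂] at m₂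
  have hf₁ : (e ⟨j, by omega⟩ ⟨j + 2, by omega⟩ * e ⟨j, by omega⟩ ⟨j + 1, by omega⟩ :
      YHAlgebra d q (j + 3)) = e ⟨j, by omega⟩ ⟨j + 1, by omega⟩ *
        e ⟨j + 1, by omega⟩ ⟨j + 2, by omega⟩ := by
    rw [← e_mul_e_trans, (commute_e_e _ _ _ _).eq]
  have hf₂ : (e ⟨j, by omega⟩ ⟨j + 2, by omega⟩ * e ⟨j + 1, by omega⟩ ⟨j + 2, by omega⟩ :
      YHAlgebra d q (j + 3)) = e ⟨j, by omega⟩ ⟨j + 1, by omega⟩ *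
        e ⟨j + 1, by omega⟩ ⟨j + 2, by omega⟩ := by
    rw [e_symm ⟨j + 1, _⟩ ⟨j + 2, _⟩, e_symm ⟨j, _⟩ ⟨j + 2, _⟩, e_symm ⟨j, _⟩ ⟨j + 1, _⟩,
      ← e_mul_e_trans]
  refine ⟨quad _, ?_, e_mul_self _ _, ?_, ge _, ?_, ?_, ?_, ?_, ?_, ?_, ?_, ?_, ?_, ?_⟩
  · rw [hg₁, gLast, g, g, ← map_mul, ← map_mul, ← map_mul, ← map_mul,
      FramedBraidGroup.σ_braid _ _ (Or.inr rfl)]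
  · rw [← map_mul, ge, map_mul]
  · rw [← map_mul, quad, map_add, map_smul, map_one, map_mul]
  · rw [he₁]; exact (commute_e_e _ _ _ _).eq
  · rw [he₁, gLast]
    simpa [Equiv.swap_apply_of_ne_of_ne n₁ n₂] using m₂ ⟨j, by omega⟩ ⟨j + 2, by omega⟩
  · rw [he₁, gLast]
    simpa [Equiv.swap_apply_of_ne_of_ne n₁ n₂] using m₂ ⟨j, by omega⟩ ⟨j + 1, by omega⟩
  · rw [he₂, hg₁]
    simpa [Equiv.swap_apply_of_ne_of_ne n₂.symm n₃.symm] using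
      m₁ ⟨j + 1, by omega⟩ ⟨j + 2, by omega⟩
  · rw [he₂, hg₁]
    simpa [Equiv.swap_apply_of_ne_of_ne n₂.symm n₃.symm] using
      m₁ ⟨j, by omega⟩ ⟨j + 2, by omega⟩
  · rw [he₁, he₂, (commute_e_e _ _ _ _).eq, hf₁]
  · rw [he₁, he₂, (commute_e_e _ _ _ _).eq, hf₂]
  · rw [he₁, he₂, hf₁]
  · rw [he₁, he₂, hf₂]

variable (d q)

/-- The idempotent `e_i`. -/
def eAdj {n : ℕ} (i : Crossing n) : YHAlgebra d q n :=
  e ⟨i.1, by have := i.2; omega⟩ ⟨i.1 + 1, i.2⟩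

/-- The subalgebra of `Y_{d,n}(q)` generated by the elements `g_i` and `e_i`. -/
def bt (n : ℕ) : Subalgebra ℂ (YHAlgebra d q n) :=
  Algebra.adjoin ℂ (Set.range (fun i : Crossing n => g d q i) ∪ Set.range (eAdj d q))

variable {d q} {n : ℕ}

omit [NeZero d] in
theorem incl_eAdj (i : Crossing n) : incl d q n (eAdj d q i) = eAdj d q i.castSucc := incl_e _ _

omit [NeZero d] in
theorem g_mem_bt (i : Crossing n) : g d q i ∈ bt d q n :=
  Algebra.subset_adjoin (Or.inl ⟨i, rfl⟩)

omit [NeZero d] in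
theorem eAdj_mem_bt (i : Crossing n) : eAdj d q i ∈ bt d q n :=
  Algebra.subset_adjoin (Or.inr ⟨i, rfl⟩)

omit [NeZero d] in
theorem incl_mem_bt {a : YHAlgebra d q n} (ha : a ∈ bt d q n) :
    incl d q n a ∈ bt d q (n + 1) := by
  suffices h : bt d q n ≤ (bt d q (n + 1)).comap (incl d q n) from h ha
  refine Algebra.adjoin_le ?_
  rintro _ (⟨i, rfl⟩ | ⟨i, rfl⟩)
  · rw [SetLike.mem_coe, Subalgebra.mem_comap, incl_g]; exact g_mem_bt _
  · rw [SetLike.mem_coe, Subalgebra.mem_comap, incl_eAdj]; exact eAdj_mem_bt _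

variable (d q) in
/-- The combinations of elements in which the last strand is involved at most once. -/
def btLastSpan (j : ℕ) : Submodule ℂ (YHAlgebra d q (j + 2)) :=
  btSpan ((bt d q (j + 1)).map (incl d q (j + 1))) (gLast d q j) (eLast d q j)

omit [NeZero d] in
-- As for the framed words, the left stabilizer of the span is a subalgebra, so generators suffice;
-- those avoiding the last strand preserve the span trivially, which leaves the last `g` and the
-- last `e`.
theorem bt_le_of_mul_mem (j : ℕ)
    (h : ∀ x ∈ ({gLast d q j, eLast d q j} : Set _), ∀ b ∈ bt d q (j + 1),
      ∀ y ∈ ({1, gLast d q j, eLast d q j, eLast d q j * gLast d q j} : Set _),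
      x * incl d q (j + 1) b * y ∈ btLastSpan d q j)
    {a : YHAlgebra d q (j + 2)} (ha : a ∈ bt d q (j + 2)) : a ∈ btLastSpan d q j := by
  have hlast : ∀ x ∈ ({gLast d q j, eLast d q j} : Set _),
      x ∈ leftStabilizer (btLastSpan d q j) := fun x hx => by
    refine mem_leftStabilizer_span ?_
    rintro _ ⟨_, ⟨b, hb, rfl⟩, y, hy, r, hr, rfl⟩
    rw [← mul_assoc, ← mul_assoc]
    exact mem_btSpan_mul hr (h x hx b hb y hy)
  suffices hle : bt d q (j + 2) ≤ leftStabilizer (btLastSpan d q j) by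
    simpa using hle ha 1 (mem_btSpan_of_mem (by simp))
  refine Algebra.adjoin_le ?_
  rintro _ (⟨i, rfl⟩ | ⟨i, rfl⟩) <;> obtain ⟨i, rfl⟩ | rfl := i.eq_castSucc_or_eq_last
  · intro x hx
    exact mul_mem_btSpan ⟨g d q i, g_mem_bt i, incl_g i⟩ hx
  · exact hlast _ (Or.inl rfl)
  · intro x hx
    exact mul_mem_btSpan ⟨eAdj d q i, eAdj_mem_bt i, incl_eAdj i⟩ hx
  · exact hlast _ (Or.inr rfl)

omit [NeZero d] in
theorem bt_one : bt d q 1 = ⊥ := by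
  rw [bt, ← Algebra.adjoin_empty]
  congr 1
  refine Set.eq_empty_of_forall_notMem ?_
  rintro _ (⟨i, rfl⟩ | ⟨i, rfl⟩) <;> exact absurd i.2 (by omega)

/-- The elements of the subalgebra generated by the `g_i` and the `e_i` are combinations of
elements in which the last strand is involved at most once. -/
theorem mem_btLastSpan (j : ℕ) {a : YHAlgebra d q (j + 2)} (ha : a ∈ bt d q (j + 2)) :
    a ∈ btLastSpan d q j := by
  induction j with
  | zero =>
    refine bt_le_of_mul_mem 0 (fun x hx b hb y hy => ?_) ha
    obtain ⟨c, rfl⟩ := Algebra.mem_bot.mp (bt_one (d := d) (q := q) ▸ hb)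
    rw [AlgHom.commutes, ← Algebra.commutes, mul_assoc, ← Algebra.smul_def]
    exact Submodule.smul_mem _ _ (mul_mem_btSpan_of_quad (g_mul_g (Crossing.last 0))
      (e_mul_self _ _) (g_mul_e_self (Crossing.last 0)) hx hy)
  | succ j ih =>
    refine bt_le_of_mul_mem (j + 1) (fun x hx b hb y hy => ?_) ha
    have hb' := ih hb
    clear hb
    induction hb' using Submodule.span_induction with
    | mem b hb =>
      obtain ⟨_, ⟨c, hc, rfl⟩, y', hy', _, ⟨c', hc', rfl⟩, rfl⟩ := hb
      -- The outer factors `c` and `c'` avoid the last two strands, hence commute with `x` and `y`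
      -- and can be pulled out. What remains is a product on three strands.
      have hxc : Commute x (incl d q (j + 2) (incl d q (j + 1) c)) := by
        rcases hx with rfl | rfl
        · exact commute_gLast_incl_incl c
        · exact commute_eLast_incl_incl c
      have hyc : Commute y (incl d q (j + 2) (incl d q (j + 1) c')) := by
        rcases hy with rfl | rfl | rfl | rfl
        · exact Commute.one_left _
        · exact commute_gLast_incl_incl c'
        · exact commute_eLast_incl_incl c'
        · exact (commute_eLast_incl_incl c').mul_left (commute_gLast_incl_incl c')
      have hy'' : incl d q (j + 2) y' ∈ ({1, incl d q (j + 2) (gLast d q j),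
          incl d q (j + 2) (eLast d q j),
          incl d q (j + 2) (eLast d q j) * incl d q (j + 2) (gLast d q j)} : Set _) := by
        rcases hy' with rfl | rfl | rfl | rfl <;> simp
      have h := (btRelations d q j).mul_mul_mem
        (P := (bt d q (j + 2)).map (incl d q (j + 2)))
        ⟨_, g_mem_bt (Crossing.last j), rfl⟩ ⟨_, eAdj_mem_bt (Crossing.last j), rfl⟩ hx hy'' hy
      have h₁ : x * incl d q (j + 2) (incl d q (j + 1) c * y' * incl d q (j + 1) c') * y =
          incl d q (j + 2) (incl d q (j + 1) c) * (x * incl d q (j + 2) y' * y) *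
            incl d q (j + 2) (incl d q (j + 1) c') := by
        rw [map_mul, map_mul, ← mul_assoc, ← mul_assoc, hxc.eq, mul_assoc _ _ y, ← hyc.eq]
        simp only [mul_assoc]
      exact h₁ ▸ mem_btSpan_mul ⟨_, incl_mem_bt hc', rfl⟩
        (mul_mem_btSpan ⟨_, incl_mem_bt hc, rfl⟩ h)
    | zero => rw [map_zero, mul_zero, zero_mul]; exact Submodule.zero_mem _
    | add b b' _ _ hb hb' =>
      rw [map_add, mul_add, add_mul]; exact Submodule.add_mem _ hb hb'
    | smul r b _ hb =>
      rw [map_smul, mul_smul_comm, smul_mul_assoc]; exact Submodule.smul_mem _ _ hb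

omit [NeZero d] in
/-- The image of the braid group lies in the subalgebra generated by the `g_i` and the `e_i`. -/
theorem ofBraid_mem_bt (β : BraidGroup n) : ofBraid d q β ∈ bt d q n := by
  have hg : ∀ i : Crossing n, ofBraid d q (BraidGroup.σ i) = g d q i := fun i =>
    congrArg (ofFramed d q) (PresentedGroup.toGroup.of _)
  suffices h : ofBraid d q β ∈ bt d q n ∧ ofBraid d q β⁻¹ ∈ bt d q n from h.1
  have hβ : β ∈ Subgroup.closure (Set.range (PresentedGroup.of (rels := {r | BraidRel n r}))) := by
    rw [PresentedGroup.closure_range_of]; trivial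
  induction hβ using Subgroup.closure_induction with
  | mem β h =>
    obtain ⟨i, rfl⟩ := h
    refine ⟨?_, ?_⟩
    · exact (hg i).symm ▸ g_mem_bt i
    · have h₁ : ofBraid d q (BraidGroup.σ i)⁻¹ = g d q i - (q - q⁻¹) • eAdj d q i := by
        have h₂ : g d q i * ofBraid d q (BraidGroup.σ i)⁻¹ = 1 := by
          rw [← hg, ← map_mul, mul_inv_cancel, map_one]
        have h₃ := congrArg (· * ofBraid d q (BraidGroup.σ i)⁻¹) (g_mul_g i)
        simp only [add_mul, smul_mul_assoc, mul_assoc, h₂, mul_one, one_mul] at h₃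
        rw [h₃, eAdj, add_sub_cancel_right]
      exact h₁ ▸ sub_mem (g_mem_bt i) (Subalgebra.smul_mem _ (eAdj_mem_bt i) _)
  | one => simp only [inv_one, map_one, and_self]; exact one_mem _
  | mul a b _ _ ha hb =>
    rw [mul_inv_rev, map_mul, map_mul]
    exact ⟨mul_mem ha.1 hb.1, mul_mem hb.2 ha.2⟩
  | inv a _ ha => rw [inv_inv]; exact ha.symm

end BT

end YokonumaHecke

namespace YokonumaHecke

/-! ### Shifting the strands -/

namespace FramedBraidGroup

variable {d n N : ℕ}

theorem strandSwap_shift (k : ℕ) (hk : n + k ≤ N) (i : Crossing n) (j : Fin n) :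
    (⟨(strandSwap i j).1 + k, by have := (strandSwap i j).2; omega⟩ : Fin N) =
      strandSwap ⟨i.1 + k, by have := i.2; omega⟩ ⟨j.1 + k, by have := j.2; omega⟩ := by
  simp only [strandSwap, Equiv.swap_apply_def, Fin.ext_iff]
  split_ifs <;> simp_all <;> omega

/-- Images of the generators under the shift by `k` strands. -/
def genShift (d k : ℕ) (hk : n + k ≤ N) : FramedGen n → FramedBraidGroup d N
  | FramedGen.sigma i => σ ⟨i.1 + k, by have := i.2; omega⟩
  | FramedGen.t j => t ⟨j.1 + k, by have := j.2; omega⟩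

/-- The homomorphism `F_{d,n} → F_{d,N}` shifting the strands by `k`. -/
def shift (d k : ℕ) (hk : n + k ≤ N) : FramedBraidGroup d n →* FramedBraidGroup d N :=
  PresentedGroup.toGroup (rels := {r | FramedRel d n r}) (f := genShift d k hk) (by
    rintro _ (⟨i, j, h⟩ | ⟨i, j, h⟩ | ⟨i, j⟩ | ⟨j, i⟩ | ⟨j⟩)
    · simp only [map_mul, map_inv, FreeGroup.lift_apply_of, mul_inv_eq_one, genShift]
      exact σ_braid _ _ (by simp only; omega)
    · simp only [map_mul, map_inv, FreeGroup.lift_apply_of, mul_inv_eq_one, genShift]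
      exact σ_comm _ _ (by simp only; omega)
    · simp only [map_mul, map_inv, FreeGroup.lift_apply_of, mul_inv_eq_one, genShift]
      exact t_comm _ _
    · simp only [map_mul, map_inv, FreeGroup.lift_apply_of, mul_inv_eq_one, genShift]
      rw [strandSwap_shift k hk]
      exact t_mul_σ _ _
    · simp only [map_pow, FreeGroup.lift_apply_of, genShift]
      exact t_pow _)

theorem shift_σ (k : ℕ) (hk : n + k ≤ N) (i : Crossing n) :
    shift d k hk (σ i) = σ ⟨i.1 + k, by have := i.2; omega⟩ := PresentedGroup.toGroup.of _

theorem shift_t (k : ℕ) (hk : n + k ≤ N) (j : Fin n) :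
    shift d k hk (t j) = t ⟨j.1 + k, by have := j.2; omega⟩ := PresentedGroup.toGroup.of _

theorem shift_incl (k : ℕ) (hk : n + k ≤ N) (f : FramedBraidGroup d n) :
    shift d k (by omega) (incl d n f) = incl d N (shift d k hk f) := by
  induction f using induction_generators with
  | hσ i => rw [incl_σ, shift_σ, shift_σ, incl_σ]; rfl
  | ht j => rw [incl_t, shift_t, shift_t, incl_t]; rfl
  | one => simp
  | mul a b ha hb => simp only [map_mul, ha, hb]
  | inv a ha => simp only [map_inv, ha]

theorem ofBraid_σ (i : Crossing n) : ofBraid d n (BraidGroup.σ i) = σ i :=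
  PresentedGroup.toGroup.of _

theorem _root_.YokonumaHecke.BraidGroup.embed_σ (k : ℕ) (hk : n + k ≤ N) (i : Crossing n) :
    BraidGroup.embed k hk (BraidGroup.σ i) = BraidGroup.σ ⟨i.1 + k, by have := i.2; omega⟩ :=
  PresentedGroup.toGroup.of _

theorem ofBraid_embed (k : ℕ) (hk : n + k ≤ N) (β : BraidGroup n) :
    ofBraid d N (BraidGroup.embed k hk β) = shift d k hk (ofBraid d n β) := by
  suffices h : (ofBraid d N).comp (BraidGroup.embed k hk) = (shift d k hk).comp (ofBraid d n) from
    DFunLike.congr_fun h β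
  refine PresentedGroup.ext fun i => ?_
  change ofBraid d N (BraidGroup.embed k hk (BraidGroup.σ i)) =
    shift d k hk (ofBraid d n (BraidGroup.σ i))
  rw [BraidGroup.embed_σ, ofBraid_σ, ofBraid_σ, shift_σ]

theorem shift_zero_succ (hk : n + 0 ≤ N) (f : FramedBraidGroup d n) :
    shift d 0 (by omega) f = incl d N (shift d 0 hk f) := by
  induction f using induction_generators with
  | hσ i => rw [shift_σ, shift_σ, incl_σ]; rfl
  | ht j => rw [shift_t, shift_t, incl_t]; rfl
  | one => simp
  | mul a b ha hb => simp only [map_mul, ha, hb]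
  | inv a ha => simp only [map_inv, ha]

theorem shift_zero_self (f : FramedBraidGroup d n) : shift d 0 le_rfl f = f := by
  induction f using induction_generators with
  | hσ i => rw [shift_σ]; rfl
  | ht j => rw [shift_t]; rfl
  | one => simp
  | mul a b ha hb => simp only [map_mul, ha, hb]
  | inv a ha => simp only [map_inv, ha]

end FramedBraidGroup

namespace YHAlgebra

variable {d : ℕ} {q : ℂ} {n N : ℕ}

/-- The algebra homomorphism `Y_{d,n}(q) → Y_{d,N}(q)` shifting the strands by `k`. -/
def shift (d : ℕ) (q : ℂ) (k : ℕ) (hk : n + k ≤ N) : YHAlgebra d q n →ₐ[ℂ] YHAlgebra d q N :=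
  RingQuot.liftAlgHom ℂ ⟨MonoidAlgebra.lift ℂ _ _ ((ofFramed d q).comp
    (FramedBraidGroup.shift d k hk)), by
      rintro _ _ ⟨i⟩
      have h := isQuadratic_ofFramed d q (⟨i.1 + k, by have := i.2; omega⟩ : Crossing N)
      simp only [eElt, map_add, map_mul, map_smul, map_one, map_sum, map_pow,
        MonoidAlgebra.lift_of, MonoidHom.comp_apply, FramedBraidGroup.shift_σ,
        FramedBraidGroup.shift_t, map_inv, smul_mul_assoc, Finset.sum_mul, smul_smul] at h ⊢
      rw [pow_two, mul_one_div, h]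
      congr 4
      simp only [add_right_comm]⟩

theorem shift_ofFramed (k : ℕ) (hk : n + k ≤ N) (f : FramedBraidGroup d n) :
    shift d q k hk (ofFramed d q f) = ofFramed d q (FramedBraidGroup.shift d k hk f) := by
  simp only [shift, ofFramed, MonoidHom.comp_apply, MonoidHom.coe_coe,
    RingQuot.liftAlgHom_mkAlgHom_apply, MonoidAlgebra.lift_of]

theorem shift_incl (k : ℕ) (hk : n + k ≤ N) (a : YHAlgebra d q n) :
    shift d q k (by omega) (incl d q n a) = incl d q N (shift d q k hk a) := by
  induction a using induction_ofFramed with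
  | of f => simp only [incl_ofFramed, shift_ofFramed, FramedBraidGroup.shift_incl k hk]
  | add a b ha hb => simp only [map_add, ha, hb]
  | smul c a ha => simp only [map_smul, ha]

theorem shift_zero_succ (hk : n + 0 ≤ N) (a : YHAlgebra d q n) :
    shift d q 0 (by omega) a = incl d q N (shift d q 0 hk a) := by
  induction a using induction_ofFramed with
  | of f => simp only [incl_ofFramed, shift_ofFramed, FramedBraidGroup.shift_zero_succ hk]
  | add a b ha hb => simp only [map_add, ha, hb]
  | smul c a ha => simp only [map_smul, ha]

theorem shift_zero_self (a : YHAlgebra d q n) : shift d q 0 le_rfl a = a := by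
  induction a using induction_ofFramed with
  | of f => rw [shift_ofFramed, FramedBraidGroup.shift_zero_self]
  | add a b ha hb => simp only [map_add, ha, hb]
  | smul c a ha => simp only [map_smul, ha]

theorem shift_g (k : ℕ) (hk : n + k ≤ N) (i : Crossing n) :
    shift d q k hk (g d q i) = g d q ⟨i.1 + k, by have := i.2; omega⟩ := by
  rw [g, shift_ofFramed, FramedBraidGroup.shift_σ, g]

theorem shift_e (k : ℕ) (hk : n + k ≤ N) (a b : Fin n) :
    shift d q k hk (e a b) =
      e ⟨a.1 + k, by have := a.2; omega⟩ ⟨b.1 + k, by have := b.2; omega⟩ := by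
  simp only [e, map_smul, map_sum, shift_ofFramed, map_pow, map_mul, map_inv,
    FramedBraidGroup.shift_t]

theorem shift_ofBraid (k : ℕ) (hk : n + k ≤ N) (β : BraidGroup n) :
    shift d q k hk (ofBraid d q β) = ofBraid d q (BraidGroup.embed k hk β) := by
  rw [ofBraid, MonoidHom.comp_apply, shift_ofFramed, ofBraid, MonoidHom.comp_apply,
    FramedBraidGroup.ofBraid_embed]

theorem shift_gLast (j k : ℕ) (hk : j + 2 + k ≤ k + (j + 2)) :
    shift d q k hk (gLast d q j) = gLast d q (k + j) := by
  rw [gLast, shift_g, gLast]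
  congr 1
  exact Subtype.ext (add_comm _ _)

theorem shift_eLast (j k : ℕ) (hk : j + 2 + k ≤ k + (j + 2)) :
    shift d q k hk (eLast d q j) = eLast d q (k + j) := by
  rw [eLast, shift_e, eLast]
  congr 1 <;> refine Fin.ext ?_ <;> simp <;> omega

end YHAlgebra

/-! ### Multiplicativity of the trace -/

namespace IsMarkovTrace

open YHAlgebra

variable {d : ℕ} [NeZero d] {q : ℂ} {x : ZMod d → ℂ} {tr : ∀ n : ℕ, YHAlgebra d q n →ₗ[ℂ] ℂ[X]}

omit [NeZero d] in
theorem tr_shift_zero (h : IsMarkovTrace d q x tr) {n N : ℕ} (hN : n + 0 ≤ N)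
    (a : YHAlgebra d q n) : tr N (shift d q 0 hN a) = tr n a := by
  induction N, hN using Nat.le_induction with
  | base => exact congrArg (tr n) (shift_zero_self a)
  | succ N hN ih => rw [shift_zero_succ hN, h.compat, ih]

/-- The value of the trace on products in which the last strand is involved at most once. -/
theorem exists_tr_incl_mul_mul_incl (h : IsMarkovTrace d q x tr) (hx : IsESolution x)
    (i j : ℕ) :
    ∀ y ∈ ({(1, 1), (gLast d q i, gLast d q j), (eLast d q i, eLast d q j),
      (eLast d q i * gLast d q i, eLast d q j * gLast d q j)} : Set (_ × _)),
      ∃ p : ℂ[X],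
        (∀ a b, tr (i + 2) (incl d q (i + 1) a * y.1 * incl d q (i + 1) b) =
          p * tr (i + 1) (a * b)) ∧
        (∀ a b, tr (j + 2) (incl d q (j + 1) a * y.2 * incl d q (j + 1) b) =
          p * tr (j + 1) (a * b)) := by
  have hcyc : ∀ (k : ℕ) (a b : YHAlgebra d q (k + 1)) (y : YHAlgebra d q (k + 2)),
      tr (k + 2) (incl d q (k + 1) a * y * incl d q (k + 1) b) =
        tr (k + 2) (incl d q (k + 1) (b * a) * y) := fun k a b y => by
    rw [h.tr_mul_comm, ← mul_assoc, map_mul (incl d q (k + 1))]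
  have hcomm : ∀ (k : ℕ) (a b : YHAlgebra d q (k + 1)), tr (k + 1) (b * a) = tr (k + 1) (a * b) :=
    fun k a b => h.tr_mul_comm _ _ _
  rintro _ (rfl | rfl | rfl | rfl)
  · refine ⟨1, fun a b => ?_, fun a b => ?_⟩ <;> simp only <;>
      rw [hcyc, mul_one, h.compat, hcomm, one_mul]
  · exact ⟨X, h.markov_gLast i, h.markov_gLast j⟩
  · refine ⟨C (ePoly x 0), fun a b => ?_, fun a b => ?_⟩ <;> simp only <;>
      rw [hcyc, h.tr_incl_mul_eLast hx, hcomm]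
  · refine ⟨X, fun a b => ?_, fun a b => ?_⟩ <;> simp only <;>
      rw [hcyc, h.tr_incl_mul_eLast_mul_gLast, hcomm]

/-- The last strand of `b` enters through one factor, and `exists_tr_incl_mul_mul_incl` removes it
at the cost of a scalar that is the same for `b` alone and for the shifted product. Membership of
`b` in `bt` matters at the end of the induction: on one strand `bt` is reduced to scalars, whereas a
framing there would lie on the strand shared with `a` and would not split off in general. -/
theorem tr_mul_shift (h : IsMarkovTrace d q x tr) (hx : IsESolution x) (k j : ℕ)
    (a : YHAlgebra d q (k + 1)) {b : YHAlgebra d q (j + 1)} (hb : b ∈ bt d q (j + 1)) :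
    tr (k + (j + 1)) (shift d q 0 (by omega) a * shift d q k (by omega) b) =
      tr (k + 1) a * tr (j + 1) b := by
  induction j with
  | zero =>
    obtain ⟨c, rfl⟩ := Algebra.mem_bot.mp (bt_one (d := d) (q := q) ▸ hb)
    rw [AlgHom.commutes, ← Algebra.commutes, ← Algebra.smul_def, map_smul, h.tr_shift_zero,
      Algebra.algebraMap_eq_smul_one, map_smul, h.tr_one, mul_smul_comm, mul_one]
  | succ j ih =>
    have hb' := mem_btLastSpan j hb
    clear hb
    induction hb' using Submodule.span_induction with
    | mem b hb =>
      obtain ⟨_, ⟨c, hc, rfl⟩, y, hy, _, ⟨c', hc', rfl⟩, rfl⟩ := hb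
      have hy' : (shift d q k (by omega) y, y) ∈ ({(1, 1), (gLast d q (k + j), gLast d q j),
          (eLast d q (k + j), eLast d q j),
          (eLast d q (k + j) * gLast d q (k + j), eLast d q j * gLast d q j)} :
            Set (YHAlgebra d q (k + (j + 2)) × YHAlgebra d q (j + 2))) := by
        rcases hy with rfl | rfl | rfl | rfl
        · left; rw [map_one]
        · right; left; rw [shift_gLast]
        · right; right; left; rw [shift_eLast]
        · right; right; right; rw [map_mul, shift_gLast, shift_eLast]; rfl
      obtain ⟨p, hp₁, hp₂⟩ := h.exists_tr_incl_mul_mul_incl hx (k + j) j _ hy'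
      have hs : shift d q 0 (by omega) a *
          shift d q k (by omega) (incl d q (j + 1) c * y * incl d q (j + 1) c') =
          incl d q (k + j + 1) (shift d q 0 (by omega) a * shift d q k (by omega) c) *
            shift d q k (by omega) y * incl d q (k + j + 1) (shift d q k (by omega) c') := by
        rw [map_mul, map_mul, shift_incl k (by omega) c, shift_incl k (by omega) c',
          shift_zero_succ (by omega) a, map_mul (incl d q _)]
        simp only [mul_assoc]
      have h₂ := ih (Subalgebra.mul_mem _ hc hc')
      rw [map_mul (shift d q k _), ← mul_assoc] at h₂
      change tr (k + j + 2) (shift d q 0 _ a *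
        shift d q k _ (incl d q (j + 1) c * y * incl d q (j + 1) c')) =
          tr (k + 1) a * tr (j + 2) (incl d q (j + 1) c * y * incl d q (j + 1) c')
      rw [hs]
      refine (hp₁ _ _).trans ((congrArg (p * ·) h₂).trans ?_)
      rw [hp₂, mul_left_comm]
    | zero => simp only [map_zero, mul_zero]
    | add b b' _ _ hb hb' => simp only [map_add, mul_add, hb, hb']
    | smul r b _ hb => simp only [map_smul, mul_smul_comm, hb]

theorem tr_connectedSum (h : IsMarkovTrace d q x tr) (hx : IsESolution x) (n m : ℕ) (hn : 1 ≤ n)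
    (hm : 1 ≤ m) (α : BraidGroup n) (β : BraidGroup m) :
    tr (n + m - 1) (ofBraid d q (BraidGroup.connectedSum hn hm α β)) =
      tr n (ofBraid d q α) * tr m (ofBraid d q β) := by
  obtain ⟨k, rfl⟩ : ∃ k, n = k + 1 := ⟨n - 1, by omega⟩
  obtain ⟨j, rfl⟩ : ∃ j, m = j + 1 := ⟨m - 1, by omega⟩
  rw [BraidGroup.connectedSum, map_mul, ← shift_ofBraid, ← shift_ofBraid,
    ← h.tr_mul_shift hx k j _ (ofBraid_mem_bt β)]
  -- The strand counts `k + 1 + (j + 1) - 1` and `k + (j + 1)` index different types; the equality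
  -- is substituted with both counts as variables.
  have key : ∀ (N N' k' : ℕ) (h₁ : k + 1 + 0 ≤ N) (h₂ : j + 1 + k' ≤ N) (h₃ : k + 1 + 0 ≤ N')
      (h₄ : j + 1 + k ≤ N'), N = N' → k' = k →
      tr N (shift d q 0 h₁ (ofBraid d q α) * shift d q k' h₂ (ofBraid d q β)) =
        tr N' (shift d q 0 h₃ (ofBraid d q α) * shift d q k h₄ (ofBraid d q β)) := by
    rintro N _ _ h₁ h₂ h₃ h₄ rfl rfl
    rfl
  exact key _ _ _ _ _ _ _ (by omega) (by omega)

end IsMarkovTrace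

end YokonumaHecke

end
open YokonumaHecke in
theorem mainTheorem8 (d : ℕ) [NeZero d] (q : ℂ) (hq : q ≠ 0)
    (x : ZMod d → ℂ) (hx : IsESolution x) :
    (∃! tr : ∀ n : ℕ, YHAlgebra d q n →ₗ[ℂ] ℂ[X], IsMarkovTrace d q x tr) ∧
    ∀ tr : ∀ n : ℕ, YHAlgebra d q n →ₗ[ℂ] ℂ[X], IsMarkovTrace d q x tr →
      ∀ (n m : ℕ) (hn : 1 ≤ n) (hm : 1 ≤ m) (α : BraidGroup n) (β : BraidGroup m),
        tr (n + m - 1) (YHAlgebra.ofBraid d q (BraidGroup.connectedSum hn hm α β)) =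
          tr n (YHAlgebra.ofBraid d q α) * tr m (YHAlgebra.ofBraid d q β) := by
  obtain ⟨tr, htr⟩ := exists_isMarkovTrace hq x hx.zero
  exact ⟨⟨tr, htr, fun tr' htr' => htr'.unique htr hx.zero⟩,
    fun tr h => h.tr_connectedSum hx⟩
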